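/- A Petri net with inhibitor and reset arcs consists of a finite set $P$ of places, a finite set $T$ of transitions, an initial marking $M_0:P\to\mathbb N$ and a flow relation $F$ with $F(p,t)\in\mathbb N\cup\{I,R\}$ and $F(t,p)\in\mathbb N$ for $p\in P$, $t\in T$; it has an inhibitor arc (resp. a reset arc) from $p$ to $t$ if $F(p,t)=I$ (resp. $F(p,t)=R$). A transition $t$ is firable at a marking $M:P\to\mathbb N$ if for every place $p$: $M(p)\ge F(p,t)$ when $F(p,t)\in\mathbb N$, and $M(p)=0$ when $F(p,t)=I$ (there is no condition when $F(p,t)=R$). Firing $t$ at $M$ gives the marking $M'$ with $M'(p)=M(p)-F(p,t)+F(t,p)$ if $F(p,t)\in\mathbb N$ and $M'(p)=F(t,p)$ if $F(p,t)\in\{I,R\}$. A marking is reachable if it is obtained from $M_0$ by firing a finite, possibly empty, sequence of transitions. **Theorem.** For Petri nets with exactly one inhibitor arc and exactly one reset arc (all other arcs being ordinary), the following problems are undecidable: 1. (Reachability) given such a net and a marking $M$, is $M$ reachable? 2. (Deadlock-freeness) given such a net, is there a reachable marking at which no transition is firable? That is, for neither problem is there an algorithm that halts with the correct answer on all such inputs.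 -/

import Mathlib

/-- The label of an arc from a place to a transition: an ordinary arc with its weight
(weight `0` means that there is no arc), an inhibitor arc, or a reset arc. -/
inductive ArcLabel : Type
  | weight (k : ℕ)
  | inhibitor
  | reset

namespace ArcLabel

/-- `ℕ ∪ {I, R}` as a disjoint union. -/
def equivSum : ArcLabel ≃ ℕ ⊕ Bool where
  toFun
    | weight k => Sum.inl k
    | inhibitor => Sum.inr false
    | reset => Sum.inr true
  invFun
    | Sum.inl k => weight k
    | Sum.inr false => inhibitor
    | Sum.inr true => reset
  left_inv a := by cases a <;> rfl
  right_inv a := by rcases a with k | _ | _ <;> rfl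

instance instPrimcodable : Primcodable ArcLabel :=
  Primcodable.ofEquiv (ℕ ⊕ Bool) equivSum

end ArcLabel

/-- A Petri net with inhibitor and reset arcs, with places `P` and transitions `T`.
The flow relation is split into its restrictions `pre` to `P × T`, with values in
`ℕ ∪ {I, R}`, and `post` to `T × P`, with values in `ℕ`. -/
structure IRPetriNet (P T : Type*) where
  pre : P → T → ArcLabel
  post : T → P → ℕ
  init : P → ℕ

namespace IRPetriNet

variable {P T : Type*}

/-- `t` is firable at `M`: every ordinary arc finds enough tokens, every inhibitor arc finds
an empty place; reset arcs impose no condition. -/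
def Firable (N : IRPetriNet P T) (M : P → ℕ) (t : T) : Prop :=
  ∀ p, match N.pre p t with
    | .weight k => k ≤ M p
    | .inhibitor => M p = 0
    | .reset => True

/-- The marking obtained by firing `t` at `M` (used only when `t` is firable at `M`): ordinary arcs
remove as many tokens as their weight, reset arcs remove all tokens, and then the tokens on
the arcs from `t` are added. -/
def fire (N : IRPetriNet P T) (M : P → ℕ) (t : T) : P → ℕ := fun p =>
  (match N.pre p t with
    | .weight k => M p - k
    | .inhibitor => M p
    | .reset => 0) + N.post t p

/-- `M` goes to `M'` by firing one transition. -/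
def Step (N : IRPetriNet P T) (M M' : P → ℕ) : Prop :=
  ∃ t, N.Firable M t ∧ M' = N.fire M t

/-- There is a (finite, possibly empty) run from the initial marking to `M`. -/
def Reachable (N : IRPetriNet P T) (M : P → ℕ) : Prop :=
  Relation.ReflTransGen N.Step N.init M

/-- Some reachable marking is a deadlock, i.e. no transition is firable at it. -/
def ReachesDeadlock (N : IRPetriNet P T) : Prop :=
  ∃ M, N.Reachable M ∧ ∀ t, ¬ N.Firable M t

/-- The set of inhibitor arcs. -/
def inhibitorArcs (N : IRPetriNet P T) : Set (P × T) :=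
  {a | N.pre a.1 a.2 = .inhibitor}

/-- The set of reset arcs. -/
def resetArcs (N : IRPetriNet P T) : Set (P × T) :=
  {a | N.pre a.1 a.2 = .reset}

/-- The net has exactly one inhibitor arc and exactly one reset arc. -/
def OneInhibitorOneReset (N : IRPetriNet P T) : Prop :=
  N.inhibitorArcs.ncard = 1 ∧ N.resetArcs.ncard = 1

end IRPetriNet

/-- The marking with places `0, …, n - 1` given by a list (missing entries are `0`). -/
def listMarking (n : ℕ) (l : List ℕ) : Fin n → ℕ := fun p => l.getD p 0

/-- Finite descriptions of finite Petri nets with inhibitor and reset arcs: the number of places,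
the number of transitions, the table of labels of arcs into the transitions, the table of
weights of arcs out of the transitions (one row for each transition, one column for each
place), and the initial marking. -/
abbrev NetCode : Type :=
  ℕ × ℕ × List (List ArcLabel) × List (List ℕ) × List ℕ

namespace NetCode

/-- The number of places. -/
abbrev numPlaces (c : NetCode) : ℕ := c.1

/-- The number of transitions. -/
abbrev numTransitions (c : NetCode) : ℕ := c.2.1

/-- The net described by a code. Missing table entries stand for absent arcs and empty places,
superfluous ones are ignored, so that every code describes a net. -/
def net (c : NetCode) : IRPetriNet (Fin c.numPlaces) (Fin c.numTransitions) where
  pre p t := (c.2.2.1.getD t []).getD p (.weight 0)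
  post t p := (c.2.2.2.1.getD t []).getD p 0
  init := listMarking c.numPlaces c.2.2.2.2

/-- Every net with places `0, …, n - 1` and transitions `0, …, m - 1` is described by a code. -/
theorem exists_net_eq {n m : ℕ} (N : IRPetriNet (Fin n) (Fin m)) :
    ∃ A B l, net (n, m, A, B, l) = N := by
  refine ⟨List.ofFn fun t => List.ofFn fun p => N.pre p t,
    List.ofFn fun t => List.ofFn fun p => N.post t p, List.ofFn N.init, ?_⟩
  cases N
  simp only [net, IRPetriNet.mk.injEq]
  refine ⟨?_, ?_, ?_⟩ <;> (funext; simp [listMarking])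

end NetCode

/-- The decision problem `Q`, restricted to the inputs in the class `C`, is decidable:
some algorithm halts on every input in `C` and answers there correctly whether `Q` holds
(nothing is asked of it on other inputs). -/
def DecidableOn {α : Type*} [Primcodable α] (C Q : α → Prop) : Prop :=
  ∃ f : α →. Bool, Partrec f ∧ ∀ a, C a → ∃ b ∈ f a, (b = true ↔ Q a)

/-! The halting problem is reduced to both questions at once. Halting has the form `∃ m, f (c, m) =
0` with `f` primitive recursive. A single counter machine `K` recognizes this relation, ending with
all registers empty (`RegProg.exists_den_iff`, `CounterMachine.exists_recognizes`), and `K` is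
turned into a net in which only the initial marking depends on the input.

The point is to do all zero tests with one inhibitor arc and one reset arc. Each register `r` has a
complement place, with `cnt r + cop r = k` between tests, and a timer satisfies `idleTime + usedTime
= size = k`, with `usedTime` empty between tests. A zero test of `r` moves tokens from `cop r` and
`idleTime` to `usedTime`; the inhibitor arc demands that `idleTime` become empty, so `k` tokens have
left `cop r` and register `r` is zero. The tokens are then moved back, and the reset arc empties
`usedTime`. If some tokens were not moved back, the reset destroys them and `idleTime + usedTime <
size` from then on. Place `pend e` remembers which test is in progress, so the two special arcs are
shared by all tests.

After halting, `drain` lowers `idleTime`, `size` and every `cop r` together. A run that lost timer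
tokens can never empty `size`, so emptying every place but `halt` certifies an honest simulation
(`Invariant.fire`, `halts_of_reachable`). Conversely, `grow` can first make `k` exceed every
register value of a given halting run (`reachable_haltMarking`). Finally, each place other than
`halt` has a transition returning the token it takes, so a deadlock is exactly a marking with all
these places empty. -/

/-- Nondeterministic register programs, built from increments, decrements and zero tests. -/
inductive RegProg (R : Type) : Type
  | inc (r : R)
  | dec (r : R)
  | zero (r : R)
  | seq (P P' : RegProg R)
  | star (P : RegProg R)

/-! ### Basic register programs. -/

namespace RegProg

section Semantics

variable {R : Type} [DecidableEq R]

/-- The input-output relation of a program; decrements block on empty registers. -/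
def den : RegProg R → (R → ℕ) → (R → ℕ) → Prop
  | inc r, s, s' => s' = Function.update s r (s r + 1)
  | dec r, s, s' => 0 < s r ∧ s' = Function.update s r (s r - 1)
  | zero r, s, s' => s r = 0 ∧ s' = s
  | seq P P', s, s' => ∃ t, P.den s t ∧ P'.den t s'
  | star P, s, s' => Relation.ReflTransGen P.den s s'

/-- Computes a loop from a guessed description `F m` of the states reachable in exactly `m` rounds.
-/
theorem den_star_iff {P : RegProg R} {s : R → ℕ} (F : ℕ → (R → ℕ) → Prop)
    (h0 : ∀ s', F 0 s' ↔ s' = s) (hs : ∀ m s', F (m + 1) s' ↔ ∃ t, F m t ∧ P.den t s')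
    (s' : R → ℕ) : (star P).den s s' ↔ ∃ m, F m s' := by
  constructor
  · intro h
    change Relation.ReflTransGen P.den s s' at h
    induction h with
    | refl => exact ⟨0, (h0 _).2 rfl⟩
    | tail _ h ih =>
      obtain ⟨m, hm⟩ := ih
      exact ⟨m + 1, (hs _ _).2 ⟨_, hm, h⟩⟩
  · rintro ⟨m, hm⟩
    induction m generalizing s' with
    | zero => rw [(h0 _).1 hm]; exact Relation.ReflTransGen.refl
    | succ m ih =>
      obtain ⟨t, ht, h⟩ := (hs _ _).1 hm
      exact Relation.ReflTransGen.tail (ih t ht) h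

/-- Sets a register to zero. -/
def clear (r : R) : RegProg R := seq (star (dec r)) (zero r)

theorem den_clear (r : R) (s s' : R → ℕ) : (clear r).den s s' ↔ s' = Function.update s r 0 := by
  have key := den_star_iff (P := dec r) (s := s)
    (fun m t => m ≤ s r ∧ t = Function.update s r (s r - m)) (by simp) (by
      intro m t
      simp only [den]
      constructor
      · rintro ⟨h, rfl⟩
        exact ⟨_, ⟨by omega, rfl⟩, by simp; omega, by ext k; simp [Function.update_apply]; grind⟩
      · rintro ⟨_, ⟨h, rfl⟩, h', rfl⟩
        simp only [Function.update_self] at h'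
        exact ⟨by omega, by ext k; simp [Function.update_apply]; grind⟩)
  change (∃ t, (star (dec r)).den s t ∧ t r = 0 ∧ s' = t) ↔ _
  simp only [key]
  constructor
  · rintro ⟨_, ⟨m, h, rfl⟩, h', rfl⟩
    simp only [Function.update_self] at h'
    rw [h']
  · rintro rfl
    exact ⟨_, ⟨s r, le_rfl, rfl⟩, by simp, by simp⟩

theorem den_star_inc (r : R) (s s' : R → ℕ) :
    (star (inc r)).den s s' ↔ ∃ m, s' = Function.update s r (s r + m) := by
  refine den_star_iff (P := inc r) (s := s) (fun m t => t = Function.update s r (s r + m))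
    (by simp) ?_ s'
  intro m t
  simp [den, add_assoc]

/-- Adds the contents of the register `i` to the register `j` and clears `i`. -/
def move (i j : R) : RegProg R := seq (star (seq (dec i) (inc j))) (zero i)

theorem den_move {i j : R} (hij : i ≠ j) (s s' : R → ℕ) :
    (move i j).den s s' ↔ s' = Function.update (Function.update s i 0) j (s j + s i) := by
  have key := den_star_iff (P := seq (dec i) (inc j)) (s := s)
    (fun m t => m ≤ s i ∧ t = Function.update (Function.update s i (s i - m)) j (s j + m))
    (by simp) (by
      intro m t
      simp only [den]
      constructor
      · rintro ⟨h, rfl⟩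
        refine ⟨_, ⟨by omega, rfl⟩, _, ⟨?_, rfl⟩, ?_⟩
        · simp [hij]; omega
        · ext k; simp [Function.update_apply]; grind
      · rintro ⟨_, ⟨h, rfl⟩, _, ⟨h', rfl⟩, rfl⟩
        simp [hij] at h'
        exact ⟨by omega, by ext k; simp [Function.update_apply]; grind⟩)
  change (∃ t, (star (seq (dec i) (inc j))).den s t ∧ t i = 0 ∧ s' = t) ↔ _
  simp only [key]
  constructor
  · rintro ⟨_, ⟨m, h, rfl⟩, h', rfl⟩
    simp [hij] at h'
    have : m = s i := by omega
    subst this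
    simp
  · rintro rfl
    exact ⟨_, ⟨s i, le_rfl, rfl⟩, by simp [hij], by simp⟩

/-- Tests the registers `i` and `j` for equality, with scratch register `b`. -/
def eqTest (i j b : R) : RegProg R :=
  seq (star (seq (dec i) (seq (dec j) (inc b)))) (seq (zero i) (seq (zero j)
    (seq (star (seq (dec b) (seq (inc i) (inc j)))) (zero b))))

/-- The first loop lowers `i` and `j` together, so both can reach zero only if they were equal; `b`
counts the rounds, and the second loop uses it to restore both. -/
theorem den_eqTest {i j b : R} (hij : i ≠ j) (hib : i ≠ b) (hjb : j ≠ b) {s : R → ℕ}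
    (hs : s b = 0) (s' : R → ℕ) : (eqTest i j b).den s s' ↔ s' = s ∧ s i = s j := by
  have key1 := den_star_iff (P := seq (dec i) (seq (dec j) (inc b))) (s := s)
    (fun m t => m ≤ s i ∧ m ≤ s j ∧ t = Function.update (Function.update
      (Function.update s i (s i - m)) j (s j - m)) b m)
    (by intro t; simp [show Function.update s b 0 = s by rw [← hs, Function.update_eq_self]]) (by
      intro m t
      simp only [den]
      constructor
      · rintro ⟨h, h1, rfl⟩
        refine ⟨_, ⟨by omega, by omega, rfl⟩, _, ⟨?_, rfl⟩, _, ⟨?_, rfl⟩, ?_⟩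
        · simp [hij, hib]; omega
        · simp [Function.update_apply, hij.symm, hjb]; omega
        · ext k; simp [Function.update_apply]; grind
      · rintro ⟨_, ⟨h, h1, rfl⟩, _, ⟨h2, rfl⟩, _, ⟨h3, rfl⟩, rfl⟩
        simp [hij, hib] at h2
        simp [Function.update_apply, hij.symm, hjb] at h3
        exact ⟨by omega, by omega, by ext k; simp [Function.update_apply]; grind⟩)
  have key2 := fun t : R → ℕ => den_star_iff (P := seq (dec b) (seq (inc i) (inc j))) (s := t)
    (fun m t' => m ≤ t b ∧ t' = Function.update (Function.update
      (Function.update t i (t i + m)) j (t j + m)) b (t b - m))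
    (by intro t; simp) (by
      intro m t'
      simp only [den]
      constructor
      · rintro ⟨h, rfl⟩
        refine ⟨_, ⟨by omega, rfl⟩, _, ⟨?_, rfl⟩, _, rfl, ?_⟩
        · simp; omega
        · ext k; simp [Function.update_apply]; grind
      · rintro ⟨_, ⟨h, rfl⟩, _, ⟨h2, rfl⟩, _, rfl, rfl⟩
        simp at h2
        exact ⟨by omega, by ext k; simp [Function.update_apply]; grind⟩)
  change (∃ t, (star _).den s t ∧ ∃ t1, (t i = 0 ∧ t1 = t) ∧ ∃ t2, (t1 j = 0 ∧ t2 = t1) ∧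
    ∃ t3, (star _).den t2 t3 ∧ t3 b = 0 ∧ s' = t3) ↔ _
  simp only [key1, key2]
  constructor
  · rintro ⟨_, ⟨m, h, h1, rfl⟩, _, ⟨h2, rfl⟩, _, ⟨h3, rfl⟩, _, ⟨m', h4, rfl⟩, h5, rfl⟩
    simp [hij, hib] at h2
    simp [hjb] at h3
    simp at h4 h5
    have e1 : m = s i := by omega
    have e2 : m' = s i := by omega
    have e3 : s j = s i := by omega
    refine ⟨?_, e3.symm⟩
    ext k; simp [Function.update_apply]; grind
  · rintro ⟨rfl, h⟩
    refine ⟨_, ⟨s' i, le_rfl, h.le, rfl⟩, _, ⟨?_, rfl⟩, _, ⟨?_, rfl⟩, _, ⟨s' i, ?_, rfl⟩, ?_, ?_⟩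
    · simp [hij, hib]
    · simp [hjb, h]
    · simp
    · simp
    · ext k; simp [Function.update_apply]; grind

end Semantics

/-! ### Verifying primitive recursive functions by tests with scratch registers. -/

/-- On states whose registers from `b` on are empty, `P` does nothing but test `Q`. -/
def Tests (P : RegProg ℕ) (b : ℕ) (Q : (ℕ → ℕ) → Prop) : Prop :=
  ∀ s, (∀ i, b ≤ i → s i = 0) → ∀ s', P.den s s' ↔ s' = s ∧ Q s

theorem Tests.congr {P : RegProg ℕ} {b : ℕ} {Q Q' : (ℕ → ℕ) → Prop} (h : Tests P b Q)
    (hQ : ∀ s, (∀ i, b ≤ i → s i = 0) → (Q s ↔ Q' s)) : Tests P b Q' := fun s hs s' => by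
  rw [h s hs, hQ s hs]

theorem Tests.and {P P' : RegProg ℕ} {b : ℕ} {Q Q' : (ℕ → ℕ) → Prop} (h : Tests P b Q)
    (h' : Tests P' b Q') : Tests (seq P P') b fun s => Q s ∧ Q' s := by
  intro s hs s'
  simp only [den, h s hs]
  constructor
  · rintro ⟨_, ⟨rfl, h1⟩, h2⟩
    have := (h' _ hs s').1 h2
    tauto
  · rintro ⟨rfl, h1, h2⟩
    exact ⟨_, ⟨rfl, h1⟩, (h' _ hs _).2 ⟨rfl, h2⟩⟩

theorem tests_zero (r b : ℕ) : Tests (zero r) b fun s => s r = 0 := fun s _ s' => by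
  simp only [den, and_comm]

theorem tests_eq {i j b : ℕ} (hij : i ≠ j) (hi : i < b) (hj : j < b) :
    Tests (eqTest i j b) b fun s => s i = s j := fun _ hs =>
  den_eqTest hij hi.ne hj.ne (hs b le_rfl)

theorem tests_succ {i j b : ℕ} (hij : i ≠ j) (hi : i < b) (hj : j < b) :
    Tests (seq (dec j) (seq (eqTest i j b) (inc j))) b fun s => s i + 1 = s j := by
  intro s hs s'
  have key : ∀ t, (eqTest i j b).den (Function.update s j (s j - 1)) t ↔ _ := fun t =>
    den_eqTest hij hi.ne hj.ne (by rw [Function.update_of_ne hj.ne', hs b le_rfl]) t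
  simp only [den]
  constructor
  · rintro ⟨_, ⟨h, rfl⟩, t, h1, rfl⟩
    obtain ⟨rfl, h2⟩ := (key t).1 h1
    simp [hij] at h2
    refine ⟨?_, by omega⟩
    ext k; simp [Function.update_apply]; grind
  · rintro ⟨rfl, h⟩
    refine ⟨_, ⟨by omega, rfl⟩, _, (key _).2 ⟨rfl, ?_⟩, ?_⟩
    · simp [hij]; omega
    · ext k; simp [Function.update_apply]; grind

/-- The language has no skip, so a loop around a harmless test stands in for it. -/
theorem tests_true (b : ℕ) : Tests (star (zero 0)) b fun _ => True := by
  intro s _ s'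
  rw [den_star_iff (P := zero 0) (s := s) (fun m s' => s' = s ∧ (m = 0 ∨ s 0 = 0)) (by simp)
    (by intro m t; simp only [den]; grind)]
  exact ⟨fun ⟨_, h⟩ => ⟨h.1, trivial⟩, fun h => ⟨0, h.1, Or.inl rfl⟩⟩

theorem Tests.forall {b m : ℕ} {Q : Fin m → (ℕ → ℕ) → Prop} (h : ∀ i, ∃ P, Tests P b (Q i)) :
    ∃ P, Tests P b fun s => ∀ i, Q i s := by
  induction m with
  | zero => exact ⟨_, (tests_true b).congr fun s _ => by simp⟩
  | succ m ih =>
    obtain ⟨P, hP⟩ := ih fun i => h i.succ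
    obtain ⟨P', hP'⟩ := h 0
    exact ⟨_, (hP'.and hP).congr fun s _ => by rw [Fin.forall_fin_succ]⟩

/-- Existential quantification is nondeterministic guessing: fill the scratch register `b`, test,
and clear it again. -/
theorem Tests.exists_one {P : RegProg ℕ} {b : ℕ} {Q : (ℕ → ℕ) → Prop} (h : Tests P (b + 1) Q) :
    Tests (seq (star (inc b)) (seq P (clear b))) b fun s => ∃ x, Q (Function.update s b x) := by
  intro s hs s'
  have hs' : ∀ x i, b + 1 ≤ i → Function.update s b x i = 0 := fun x i hi => by
    rw [Function.update_of_ne (by omega), hs i (by omega)]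
  have hb := hs b le_rfl
  have hu : ∀ x, Function.update (Function.update s b x) b 0 = s := fun x => by
    rw [Function.update_idem, ← hb, Function.update_eq_self]
  change (∃ t, (star (inc b)).den s t ∧ ∃ t', P.den t t' ∧ (clear b).den t' s') ↔ _
  simp only [den_star_inc, den_clear, hb, zero_add]
  constructor
  · rintro ⟨_, ⟨x, rfl⟩, t', h1, rfl⟩
    obtain ⟨rfl, h2⟩ := (h _ (hs' x) _).1 h1
    exact ⟨hu x, x, h2⟩
  · rintro ⟨rfl, x, hx⟩
    exact ⟨_, ⟨x, rfl⟩, _, (h _ (hs' x) _).2 ⟨rfl, hx⟩, (hu x).symm⟩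

/-- Iterated guessing: `t` is the state with arbitrary contents in the `m` scratch registers from
`b` on. -/
theorem Tests.exists {b m : ℕ} : ∀ {P : RegProg ℕ} {Q : (ℕ → ℕ) → Prop}, Tests P (b + m) Q →
    ∃ P', Tests P' b fun s => ∃ t, (∀ i, i < b → t i = s i) ∧ (∀ i, b + m ≤ i → t i = 0) ∧ Q t := by
  induction m with
  | zero =>
    intro P Q h
    refine ⟨P, h.congr fun s hs => ⟨fun h => ⟨s, fun _ _ => rfl, hs, h⟩, ?_⟩⟩
    rintro ⟨t, h1, h2, h3⟩
    have : t = s := by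
      ext i
      by_cases hi : i < b
      · exact h1 i hi
      · rw [h2 i (by omega), hs i (by omega)]
    exact this ▸ h3
  | succ m ih =>
    intro P Q h
    obtain ⟨P', h'⟩ := ih (Tests.exists_one (b := b + m) (by rwa [add_assoc]))
    refine ⟨P', h'.congr fun s hs => ⟨?_, ?_⟩⟩
    · rintro ⟨t, h1, h2, x, h3⟩
      refine ⟨_, fun i hi => ?_, fun i hi => ?_, h3⟩
      · rw [Function.update_of_ne (by omega), h1 i hi]
      · rw [Function.update_of_ne (by omega), h2 i (by omega)]
    · rintro ⟨t, h1, h2, h3⟩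
      refine ⟨Function.update t (b + m) 0, fun i hi => ?_, fun i hi => ?_, t (b + m), ?_⟩
      · rw [Function.update_of_ne (by omega), h1 i hi]
      · rcases eq_or_ne i (b + m) with rfl | hne
        · simp
        · rw [Function.update_of_ne hne, h2 i (by omega)]
      · simpa using h3

-- Programs verify a value already present in register `y` instead of computing it. This makes
-- composition a matter of guessing intermediate values. The inputs `xs` may repeat, but `y` must
-- differ from them because `eqTest` needs distinct registers.
open List.Vector in
theorem exists_tests_of_primrec {n : ℕ} {f : List.Vector ℕ n → ℕ} (hf : Nat.Primrec' f) :
    ∀ (xs : Fin n → ℕ) (y b : ℕ), (∀ i, xs i < b) → y < b → (∀ i, xs i ≠ y) →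
      ∃ P, Tests P b fun s => f (ofFn fun i => s (xs i)) = s y := by
  induction hf with
  | zero => exact fun xs y b _ _ _ => ⟨_, (tests_zero y b).congr fun s _ => eq_comm⟩
  | succ =>
    intro xs y b hx hy hxy
    exact ⟨_, (tests_succ (hxy 0) (hx 0) hy).congr fun s _ => by simp [ofFn]⟩
  | get i =>
    intro xs y b hx hy hxy
    exact ⟨_, (tests_eq (hxy i) (hx i) hy).congr fun s _ => by simp⟩
  | @comp n m f g _ _ ihf ihg =>
    intro xs y b hx hy hxy
    -- Registers `b, …, b + m - 1` hold the guessed values of the inner functions.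
    obtain ⟨P, hP⟩ := ihf (fun i : Fin m => b + i) y (b + m) (fun i => by omega) (by omega)
      (fun i => by omega)
    obtain ⟨P', hP'⟩ := Tests.forall fun i : Fin m => ihg i xs (b + i) (b + m)
      (fun j => (hx j).trans_le (by omega)) (by omega) (fun j => by have := hx j; omega)
    obtain ⟨P'', hP''⟩ := (hP'.and hP).exists
    refine ⟨P'', hP''.congr fun s hs => ⟨?_, fun h => ?_⟩⟩
    · rintro ⟨t, h1, h2, h3, h4⟩
      rw [h1 y hy] at h4
      simp only [h1 _ (hx _)] at h3
      simpa only [h3] using h4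
    · refine ⟨fun i => if i < b then s i else if hi : i - b < m then
        g ⟨i - b, hi⟩ (ofFn fun j => s (xs j)) else 0, fun i hi => by simp [hi], fun i hi => ?_, ?_⟩
      · beta_reduce
        rw [if_neg (by omega), dif_neg (by omega)]
      · simpa [hx, hy] using h
  | @prec n f g _ _ ihf ihg =>
    intro xs y b hx hy hxy
    -- Register `b` is the recursion index, `b + 1` the current value, and `b + 2` the guess for the
    -- next value, verified by `Pg`.
    obtain ⟨Pf, hPf⟩ := ihf (fun i => xs i.succ) (b + 1) (b + 2) (fun i => by have := hx i.succ; omega)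
      (by omega) (fun i => by have := hx i.succ; omega)
    obtain ⟨Pg, hPg⟩ := ihg (Fin.cons b (Fin.cons (b + 1) fun i => xs i.succ)) (b + 2) (b + 3)
      (by
        intro i
        refine Fin.cases (by simp) (fun i => Fin.cases (by simp) (fun i => ?_) i) i
        have := hx i.succ
        simp only [Fin.cons_succ]; omega) (by omega)
      (by
        intro i
        refine Fin.cases (by simp) (fun i => Fin.cases (by simp) (fun i => ?_) i) i
        have := hx i.succ
        simp only [Fin.cons_succ]; omega)
    let body : RegProg ℕ :=
      seq (star (inc (b + 2))) (seq Pg (seq (clear (b + 1)) (seq (move (b + 2) (b + 1)) (inc b))))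
    -- The loop may stop at any time; this test accepts only if the index equals the recursion
    -- argument and the value equals `y`.
    obtain ⟨PE, hE⟩ : ∃ PE, Tests PE (b + 2) _ := ⟨_, (tests_eq (b := b + 2) (i := b) (j := xs 0) (hx 0).ne' (by omega)
      ((hx 0).trans (by omega))).and (tests_eq (b := b + 2) (i := b + 1) (j := y) (by omega)
      (by omega) (by omega))⟩
    refine ⟨seq (star (inc (b + 1))) (seq Pf (seq (star body) (seq PE (seq (clear b)
      (clear (b + 1)))))), fun s hs s' => ?_⟩
    have hb := hs b le_rfl
    have hb1 := hs (b + 1) (by omega)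
    set st : ℕ → ℕ → ℕ → ℕ := fun i a => Function.update (Function.update s b i) (b + 1) a with hst
    set v := ofFn fun i => s (xs i.succ) with hv
    have hvx : ∀ i a, (ofFn fun j => st i a (xs (Fin.succ j))) = v := fun i a => by
      rw [hv]; congr 1; ext j
      have := hx j.succ
      simp only [hst]
      rw [Function.update_of_ne (by omega), Function.update_of_ne (by omega)]
    have hsupp : ∀ i a k, b + 2 ≤ k → st i a k = 0 := fun i a k hk => by
      simp only [hst]
      rw [Function.update_of_ne (by omega), Function.update_of_ne (by omega), hs k (by omega)]
    have hbody : ∀ i a t, body.den (st i a) t ↔ t = st (i + 1) (g (i ::ᵥ a ::ᵥ v)) := by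
      intro i a t
      have hgv : ∀ x, (ofFn fun j => Function.update (st i a) (b + 2) x
          ((Fin.cons b (Fin.cons (b + 1) fun i => xs i.succ) : Fin (n + 2) → ℕ) j))
          = i ::ᵥ a ::ᵥ v := fun x => by
        have h1 : ∀ j, Function.update (st i a) (b + 2) x (xs (Fin.succ j)) = st i a (xs j.succ) :=
          fun j => by have := hx j.succ; rw [Function.update_of_ne (by omega)]
        simp only [ofFn, Fin.cons_zero, Fin.cons_succ, h1, hvx]
        simp [hst]
      have hsup : ∀ x k, b + 3 ≤ k → Function.update (st i a) (b + 2) x k = 0 := fun x k hk => by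
        rw [Function.update_of_ne (by omega), hsupp _ _ _ (by omega)]
      have hfin : ∀ x, Function.update (Function.update (Function.update (Function.update
          (Function.update (st i a) (b + 2) x) (b + 1) 0) (b + 2) 0) (b + 1) x) b (i + 1)
          = st (i + 1) x := fun x => by
        ext k; simp only [hst, Function.update_apply]; grind
      change (∃ t1, (star (inc (b + 2))).den (st i a) t1 ∧ ∃ t2, Pg.den t1 t2 ∧ ∃ t3,
        (clear (b + 1)).den t2 t3 ∧ ∃ t4, (move (b + 2) (b + 1)).den t3 t4 ∧
        t = Function.update t4 b (t4 b + 1)) ↔ _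
      simp only [den_star_inc, den_clear, den_move (show b + 2 ≠ b + 1 by omega),
        hsupp i a (b + 2) le_rfl, zero_add]
      constructor
      · rintro ⟨_, ⟨x, rfl⟩, _, h1, _, rfl, _, rfl, rfl⟩
        obtain ⟨rfl, h2⟩ := (hPg _ (hsup x) _).1 h1
        rw [hgv, Function.update_self] at h2
        subst h2
        rw [← hfin]
        simp [hst]
      · rintro rfl
        refine ⟨_, ⟨_, rfl⟩, _, (hPg _ (hsup (g (i ::ᵥ a ::ᵥ v))) _).2 ⟨rfl, ?_⟩, _, rfl, _, rfl, ?_⟩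
        · beta_reduce
          rw [hgv, Function.update_self]
        · rw [← hfin]
          simp [hst]
    -- Verified guesses force the loop to be deterministic: after `m` rounds the state is `st m (val
    -- m)`.
    let val : ℕ → ℕ := fun m => Nat.rec (f v) (fun y IH => g (y ::ᵥ IH ::ᵥ v)) m
    have hstar := den_star_iff (P := body) (s := st 0 (val 0)) (fun m t => t = st m (val m))
      (fun _ => Iff.rfl) (fun m t => by simp only [exists_eq_left, hbody]; rfl)
    have hguess : ∀ x, Function.update s (b + 1) x = st 0 x := fun x => by
      ext k; simp only [hst, Function.update_apply]; grind
    have hclear : ∀ i a, Function.update (Function.update (st i a) b 0) (b + 1) 0 = s := fun i a => by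
      ext k; simp only [hst, Function.update_apply]; grind
    have hmem : ∀ i a, (st i a b = st i a (xs 0) ∧ st i a (b + 1) = st i a y) ↔
        i = s (xs 0) ∧ a = s y := fun i a => by
      have := hx 0
      simp only [hst, Function.update_apply]
      grind
    have hgoal : (ofFn fun i => s (xs i)) = s (xs 0) ::ᵥ v := rfl
    beta_reduce
    rw [hgoal]
    simp only [head_cons, tail_cons]
    change (∃ t1, (star (inc (b + 1))).den s t1 ∧ ∃ t2, Pf.den t1 t2 ∧ ∃ t3,
        (star body).den t2 t3 ∧ ∃ t4, PE.den t3 t4 ∧ ∃ t5, (clear b).den t4 t5 ∧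
        (clear (b + 1)).den t5 s') ↔ _ ∧ val (s (xs 0)) = s y
    simp only [den_star_inc, den_clear, hb1, zero_add]
    constructor
    · rintro ⟨_, ⟨x, rfl⟩, _, h1, _, h2, _, h3, _, rfl, rfl⟩
      rw [hguess] at h1
      obtain ⟨rfl, h4⟩ := (hPf _ (hsupp 0 x) _).1 h1
      rw [hvx] at h4
      have h5 : x = val 0 := by rw [show val 0 = f v from rfl, h4]; simp [hst]
      subst h5
      obtain ⟨m, rfl⟩ := (hstar _).1 h2
      obtain ⟨rfl, h6⟩ := (hE _ (hsupp _ _) _).1 h3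
      obtain ⟨rfl, h7⟩ := (hmem _ _).1 h6
      exact ⟨hclear _ _, h7⟩
    · rintro ⟨rfl, h⟩
      refine ⟨_, ⟨val 0, rfl⟩, st 0 (val 0), ?_, _, (hstar _).2 ⟨s' (xs 0), rfl⟩, _,
        (hE _ (hsupp _ _) _).2 ⟨rfl, (hmem _ _).2 ⟨rfl, h⟩⟩, _, rfl, (hclear _ _).symm⟩
      rw [hguess]
      refine (hPf _ (hsupp 0 _) _).2 ⟨rfl, ?_⟩
      beta_reduce
      rw [hvx]
      simp [hst, val]

/-- A set defined by an existential quantifier over a primitive recursive relation is the set of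
inputs on which some program can terminate; moreover it then terminates with empty registers. -/
theorem exists_den_iff {f : List.Vector ℕ 2 → ℕ} (hf : Nat.Primrec' f) :
    ∃ P : RegProg ℕ, ∀ n s', P.den (Pi.single 0 n) s' ↔
      s' = 0 ∧ ∃ k, f (n ::ᵥ k ::ᵥ List.Vector.nil) = 0 := by
  -- Register `0` holds the input; registers `1` and `2` hold the guessed witness and the value of
  -- `f`, which is then tested to be zero.
  obtain ⟨P, hP⟩ := exists_tests_of_primrec hf ![0, 1] 2 3
    (by intro i; fin_cases i <;> simp) (by simp) (by intro i; fin_cases i <;> simp)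
  obtain ⟨P', hP'⟩ := Tests.exists (b := 1) (m := 2) (hP.and (tests_zero 2 3))
  refine ⟨seq P' (clear 0), fun n s' => ?_⟩
  change (∃ t, P'.den (Pi.single 0 n) t ∧ (clear 0).den t s') ↔ _
  have hs : ∀ i, 1 ≤ i → (Pi.single 0 n : ℕ → ℕ) i = 0 := fun i hi => by
    rw [Pi.single_apply, if_neg (by omega)]
  simp only [hP' _ hs, den_clear, and_assoc, exists_eq_left]
  have h0 : Function.update (Pi.single 0 n : ℕ → ℕ) 0 0 = 0 := by
    ext k
    by_cases hk : k = 0 <;> simp [hk]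
  rw [h0, and_comm]
  refine and_congr_right fun _ => ⟨?_, ?_⟩
  · rintro ⟨t, h1, -, h2, h3⟩
    refine ⟨t 1, ?_⟩
    rw [h3] at h2
    have h4 : t 0 = n := by simpa using h1 0 (by simp)
    simpa [List.Vector.ofFn, h4] using h2
  · rintro ⟨k, hk⟩
    refine ⟨Function.update (Pi.single 0 n) 1 k, fun i hi => ?_, fun i hi => ?_, ?_, ?_⟩
    · rw [Function.update_of_ne (by omega)]
    · rw [Function.update_of_ne (by omega), hs i (by omega)]
    · simpa [List.Vector.ofFn, Function.update_apply] using hk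
    · simp

end RegProg

/-! ### Compiling programs to finite graphs. -/

/-- The labels of the edges of a counter machine. -/
inductive CounterOp (R : Type) : Type
  | skip
  | inc (r : R)
  | dec (r : R)
  | zero (r : R)

/-- The effect of an edge label on the registers. -/
def CounterOp.den {R : Type} [DecidableEq R] : CounterOp R → (R → ℕ) → (R → ℕ) → Prop
  | skip, s, s' => s' = s
  | inc r, s, s' => s' = Function.update s r (s r + 1)
  | dec r, s, s' => 0 < s r ∧ s' = Function.update s r (s r - 1)
  | zero r, s, s' => s r = 0 ∧ s' = s

/-- A nondeterministic counter machine with registers `R`, as a finite graph with labelled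
edges. -/
structure CounterMachine (R : Type) where
  State : Type
  Edge : Type
  [finState : Finite State]
  [finEdge : Finite Edge]
  src : Edge → State
  op : Edge → CounterOp R
  dst : Edge → State
  start : State
  finish : State

namespace CounterMachine

variable {R : Type} [DecidableEq R]

/-- One step of a counter machine. -/
def Step (K : CounterMachine R) (x y : K.State × (R → ℕ)) : Prop :=
  ∃ e, K.src e = x.1 ∧ K.dst e = y.1 ∧ (K.op e).den x.2 y.2

theorem run_map {K L : CounterMachine R} (g : K.State → L.State) (h : K.Edge → L.Edge)
    (hsrc : ∀ e, L.src (h e) = g (K.src e)) (hop : ∀ e, L.op (h e) = K.op e)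
    (hdst : ∀ e, L.dst (h e) = g (K.dst e)) {x y : K.State × (R → ℕ)}
    (hxy : Relation.ReflTransGen K.Step x y) :
    Relation.ReflTransGen L.Step (g x.1, x.2) (g y.1, y.2) := by
  induction hxy with
  | refl => exact .refl
  | tail _ hs ih =>
    obtain ⟨e, h1, h2, h3⟩ := hs
    exact ih.tail ⟨h e, by rw [hsrc, h1], by rw [hdst, h2], by rwa [hop]⟩

/-- The relation between the registers at the start and those at the end of a run. -/
def Computes (K : CounterMachine R) (ρ : (R → ℕ) → (R → ℕ) → Prop) : Prop :=
  ∀ s s', Relation.ReflTransGen K.Step (K.start, s) (K.finish, s') ↔ ρ s s'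

/-- The machine with a single edge. -/
def single (o : CounterOp R) : CounterMachine R where
  State := Bool
  Edge := Unit
  src _ := false
  op _ := o
  dst _ := true
  start := false
  finish := true

theorem computes_single (o : CounterOp R) : (single o).Computes o.den := by
  intro s s'
  constructor
  · suffices ∀ y, Relation.ReflTransGen (single o).Step (false, s) y →
        y = (false, s) ∨ y.1 = true ∧ o.den s y.2 by
      intro h
      simpa [single] using this _ h
    intro y hy
    induction hy with
    | refl => exact Or.inl rfl
    | tail _ h ih =>
      obtain ⟨e, h1, h2, h3⟩ := h
      rcases ih with rfl | ih
      · exact Or.inr ⟨h2.symm, h3⟩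
      · exact absurd (h1.trans ih.1) (by simp [single])
  · exact fun h => Relation.ReflTransGen.single ⟨(), rfl, rfl, h⟩

/-- The sequential composition of two machines. -/
def seq (K L : CounterMachine R) : CounterMachine R where
  State := K.State ⊕ L.State
  Edge := Option (K.Edge ⊕ L.Edge)
  finState := haveI := K.finState; haveI := L.finState; inferInstance
  finEdge := haveI := K.finEdge; haveI := L.finEdge; inferInstance
  src
    | none => .inl K.finish
    | some (.inl e) => .inl (K.src e)
    | some (.inr e) => .inr (L.src e)
  op
    | none => .skip
    | some (.inl e) => K.op e
    | some (.inr e) => L.op e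
  dst
    | none => .inr L.start
    | some (.inl e) => .inl (K.dst e)
    | some (.inr e) => .inr (L.dst e)
  start := .inl K.start
  finish := .inr L.finish

/-- No edge leads back from `L` to `K`, so a run splits at its unique use of the connecting edge. -/
theorem computes_seq {K L : CounterMachine R} {ρ σ : (R → ℕ) → (R → ℕ) → Prop}
    (hK : K.Computes ρ) (hL : L.Computes σ) :
    (seq K L).Computes fun s s' => ∃ t, ρ s t ∧ σ t s' := by
  intro s s'
  constructor
  · suffices ∀ y, Relation.ReflTransGen (seq K L).Step (.inl K.start, s) y →
        (∀ q, y.1 = .inl q → Relation.ReflTransGen K.Step (K.start, s) (q, y.2)) ∧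
        (∀ q, y.1 = .inr q → ∃ t, ρ s t ∧ Relation.ReflTransGen L.Step (L.start, t) (q, y.2)) by
      intro h
      obtain ⟨t, h1, h2⟩ := (this _ h).2 _ rfl
      exact ⟨t, h1, (hL _ _).1 h2⟩
    intro y hy
    induction hy with
    | refl => exact ⟨fun q hq => by cases hq; exact .refl, fun q hq => by cases hq⟩
    | @tail y z _ h ih =>
      obtain ⟨y, t⟩ := y
      obtain ⟨z, t'⟩ := z
      obtain ⟨e, h1, h2, h3⟩ := h
      rcases e with - | e | e <;> obtain rfl : _ = y := h1 <;> obtain rfl : _ = z := h2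
      · refine ⟨fun q hq => (by cases hq), fun q hq => ?_⟩
        cases hq
        obtain rfl : t' = t := h3
        exact ⟨t', (hK _ _).1 (ih.1 _ rfl), .refl⟩
      · refine ⟨fun q hq => ?_, fun q hq => (by cases hq)⟩
        cases hq
        exact (ih.1 _ rfl).tail ⟨e, rfl, rfl, h3⟩
      · refine ⟨fun q hq => (by cases hq), fun q hq => ?_⟩
        cases hq
        obtain ⟨u, hu, hu'⟩ := ih.2 _ rfl
        exact ⟨u, hu, hu'.tail ⟨e, rfl, rfl, h3⟩⟩
  · rintro ⟨t, h1, h2⟩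
    have h1' := run_map (L := seq K L) .inl (some ∘ .inl) (fun _ => rfl) (fun _ => rfl)
      (fun _ => rfl) ((hK _ _).2 h1)
    have h2' := run_map (L := seq K L) .inr (some ∘ .inr) (fun _ => rfl) (fun _ => rfl)
      (fun _ => rfl) ((hL _ _).2 h2)
    have hstep : (seq K L).Step (.inl K.finish, t) (.inr L.start, t) := ⟨none, rfl, rfl, rfl⟩
    exact (h1'.tail hstep).trans h2'

/-- The iteration of a machine. -/
def star (K : CounterMachine R) : CounterMachine R where
  State := Option K.State
  Edge := Bool ⊕ K.Edge
  finState := haveI := K.finState; inferInstance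
  finEdge := haveI := K.finEdge; inferInstance
  src
    | .inl true => none
    | .inl false => some K.finish
    | .inr e => some (K.src e)
  op
    | .inl _ => .skip
    | .inr e => K.op e
  dst
    | .inl true => some K.start
    | .inl false => none
    | .inr e => some (K.dst e)
  start := none
  finish := none

/-- The fresh state `none` separates rounds: `K` is entered only at its start and left only at its
finish. -/
theorem computes_star {K : CounterMachine R} {ρ : (R → ℕ) → (R → ℕ) → Prop} (hK : K.Computes ρ) :
    (star K).Computes (Relation.ReflTransGen ρ) := by
  intro s s'
  constructor
  · suffices ∀ y, Relation.ReflTransGen (star K).Step (none, s) y →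
        (y.1 = none → Relation.ReflTransGen ρ s y.2) ∧
        (∀ q, y.1 = some q → ∃ t, Relation.ReflTransGen ρ s t ∧
          Relation.ReflTransGen K.Step (K.start, t) (q, y.2)) from
      fun h => (this _ h).1 rfl
    intro y hy
    induction hy with
    | refl => exact ⟨fun _ => .refl, fun q hq => by cases hq⟩
    | @tail y z _ h ih =>
      obtain ⟨y, t⟩ := y
      obtain ⟨z, t'⟩ := z
      obtain ⟨e, h1, h2, h3⟩ := h
      rcases e with (- | -) | e <;> obtain rfl : _ = y := h1 <;> obtain rfl : _ = z := h2
      · refine ⟨fun _ => ?_, fun q hq => (by cases hq)⟩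
        obtain rfl : t' = t := h3
        obtain ⟨u, hu, hu'⟩ := ih.2 _ rfl
        exact hu.tail ((hK _ _).1 hu')
      · refine ⟨fun hq => (by cases hq), fun q hq => ?_⟩
        cases hq
        obtain rfl : t' = t := h3
        exact ⟨t', ih.1 rfl, .refl⟩
      · refine ⟨fun hq => (by cases hq), fun q hq => ?_⟩
        cases hq
        obtain ⟨u, hu, hu'⟩ := ih.2 _ rfl
        exact ⟨u, hu, hu'.tail ⟨e, rfl, rfl, h3⟩⟩
  · intro h
    induction h with
    | refl => exact .refl
    | @tail t u _ h ih =>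
      have h' := run_map (L := star K) some .inr (fun _ => rfl) (fun _ => rfl) (fun _ => rfl)
        ((hK _ _).2 h)
      have hstart : (star K).Step (none, t) (some K.start, t) := ⟨.inl true, rfl, rfl, rfl⟩
      have hfinish : (star K).Step (some K.finish, u) (none, u) := ⟨.inl false, rfl, rfl, rfl⟩
      exact ((Relation.ReflTransGen.tail ih hstart).trans h').tail hfinish

theorem exists_computes_den (P : RegProg R) : ∃ K : CounterMachine R, K.Computes P.den := by
  induction P with
  | inc r => exact ⟨_, computes_single (.inc r)⟩
  | dec r => exact ⟨_, computes_single (.dec r)⟩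
  | zero r => exact ⟨_, computes_single (.zero r)⟩
  | seq P P' h h' =>
    obtain ⟨K, hK⟩ := h
    obtain ⟨L, hL⟩ := h'
    exact ⟨_, computes_seq hK hL⟩
  | star P h =>
    obtain ⟨K, hK⟩ := h
    exact ⟨_, computes_star hK⟩

end CounterMachine

/-! ### Restriction to finitely many registers. -/

namespace RegProg

/-- Renames the registers of a program. -/
def map {R R' : Type} (g : R → R') : RegProg R → RegProg R'
  | inc r => inc (g r)
  | dec r => dec (g r)
  | zero r => zero (g r)
  | seq P P' => seq (P.map g) (P'.map g)
  | star P => star (P.map g)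

theorem exists_map_eq (P : RegProg ℕ) :
    ∃ k, ∀ n, k ≤ n → ∃ P' : RegProg (Fin n), P'.map Fin.val = P := by
  induction P with
  | inc r => exact ⟨r + 1, fun n hn => ⟨inc ⟨r, hn⟩, rfl⟩⟩
  | dec r => exact ⟨r + 1, fun n hn => ⟨dec ⟨r, hn⟩, rfl⟩⟩
  | zero r => exact ⟨r + 1, fun n hn => ⟨zero ⟨r, hn⟩, rfl⟩⟩
  | seq P Q hP hQ =>
    obtain ⟨k, hk⟩ := hP
    obtain ⟨l, hl⟩ := hQ
    refine ⟨max k l, fun n hn => ?_⟩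
    obtain ⟨P', rfl⟩ := hk n (le_of_max_le_left hn)
    obtain ⟨Q', rfl⟩ := hl n (le_of_max_le_right hn)
    exact ⟨seq P' Q', rfl⟩
  | star P hP =>
    obtain ⟨k, hk⟩ := hP
    refine ⟨k, fun n hn => ?_⟩
    obtain ⟨P', rfl⟩ := hk n hn
    exact ⟨star P', rfl⟩

variable {R R' : Type} [DecidableEq R] [DecidableEq R']

theorem den_comp_of_den_map {g : R → R'} (hg : Function.Injective g) (P : RegProg R) :
    ∀ s s', (P.map g).den s s' → P.den (s ∘ g) (s' ∘ g) := by
  induction P with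
  | inc r => rintro s _ rfl; exact Function.update_comp_eq_of_injective _ hg _ _
  | dec r => rintro s _ ⟨h, rfl⟩; exact ⟨h, Function.update_comp_eq_of_injective _ hg _ _⟩
  | zero r => rintro s _ ⟨h, rfl⟩; exact ⟨h, rfl⟩
  | seq P P' h h' => rintro s s' ⟨t, h1, h2⟩; exact ⟨_, h _ _ h1, h' _ _ h2⟩
  | star P h =>
    intro s s' hs
    change Relation.ReflTransGen (P.map g).den s s' at hs
    exact hs.lift (· ∘ g) h

theorem exists_den_map {g : R → R'} (hg : Function.Injective g) (P : RegProg R) :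
    ∀ s t', P.den (s ∘ g) t' → ∃ s', t' = s' ∘ g ∧ (P.map g).den s s' := by
  induction P with
  | inc r => rintro s _ rfl; exact ⟨_, (Function.update_comp_eq_of_injective _ hg _ _).symm, rfl⟩
  | dec r =>
    rintro s _ ⟨h, rfl⟩
    exact ⟨_, (Function.update_comp_eq_of_injective _ hg _ _).symm, h, rfl⟩
  | zero r => rintro s _ ⟨h, rfl⟩; exact ⟨s, rfl, h, rfl⟩
  | seq P P' h h' =>
    rintro s t' ⟨t, h1, h2⟩
    obtain ⟨u, rfl, hu⟩ := h _ _ h1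
    obtain ⟨v, rfl, hv⟩ := h' _ _ h2
    exact ⟨v, rfl, u, hu, hv⟩
  | star P h =>
    intro s t' ht
    change Relation.ReflTransGen P.den (s ∘ g) t' at ht
    induction ht with
    | refl => exact ⟨s, rfl, .refl⟩
    | tail _ hd ih =>
      obtain ⟨u, rfl, hu⟩ := ih
      obtain ⟨v, rfl, hv⟩ := h _ _ hd
      exact ⟨v, rfl, Relation.ReflTransGen.tail hu hv⟩

end RegProg

/-- Every existential quantification over a primitive recursive relation is recognized by a
counter machine with finitely many registers. -/
theorem CounterMachine.exists_recognizes {f : List.Vector ℕ 2 → ℕ} (hf : Nat.Primrec' f) :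
    ∃ (k : ℕ) (K : CounterMachine (Fin (k + 1))), ∀ n,
      Relation.ReflTransGen K.Step (K.start, Pi.single 0 n) (K.finish, 0) ↔
        ∃ m, f (n ::ᵥ m ::ᵥ List.Vector.nil) = 0 := by
  obtain ⟨P, hP⟩ := RegProg.exists_den_iff hf
  obtain ⟨k, hk⟩ := P.exists_map_eq
  obtain ⟨P', rfl⟩ := hk (k + 1) (by omega)
  obtain ⟨K, hK⟩ := CounterMachine.exists_computes_den P'
  refine ⟨k, K, fun n => ?_⟩
  have hs : (Pi.single 0 n : Fin (k + 1) → ℕ) = (Pi.single 0 n : ℕ → ℕ) ∘ Fin.val := by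
    ext i
    simp only [Function.comp_apply, Pi.single_apply, Fin.ext_iff, Fin.val_zero]
  rw [hK, hs]
  constructor
  · intro h
    obtain ⟨s', -, h'⟩ := P'.exists_den_map Fin.val_injective _ _ h
    exact ((hP n _).1 h').2
  · intro h
    exact P'.den_comp_of_den_map Fin.val_injective _ _ ((hP n 0).2 ⟨rfl, h⟩)

/-! ### The net of a counter machine. -/

namespace CounterMachine

/-- The places of the net of a counter machine: control states, suspended edges, the halting
place, the counters `cnt r` and their complements `cop r`, a timer (`idleTime` and `usedTime`)
of total size `size`, and the three modes of the zero test. -/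
inductive Place (Q E R : Type) : Type
  | st (q : Q)
  | pend (e : E)
  | halt
  | cnt (r : R)
  | cop (r : R)
  | idleTime
  | usedTime
  | size
  | counting
  | restoring
  | restored

/-- The transitions of the net of a counter machine. The transition `tested` carries the inhibitor
arc and the transition `reset` carries the reset arc. -/
inductive Trans (Q E R : Type) : Type
  | fire (e : E)
  | count (e : E)
  | restore (e : E)
  | resume (e : E)
  | tested
  | reset
  | grow
  | finish
  | drain
  | idle (p : {p : Place Q E R // p ≠ .halt})

theorem Place.finite (Q E R : Type) [Finite Q] [Finite E] [Finite R] : Finite (Place Q E R) := by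
  let f : Q ⊕ E ⊕ R ⊕ R ⊕ Fin 7 → Place Q E R
    | .inl q => .st q
    | .inr (.inl e) => .pend e
    | .inr (.inr (.inl r)) => .cnt r
    | .inr (.inr (.inr (.inl r))) => .cop r
    | .inr (.inr (.inr (.inr i))) =>
      ![.halt, .idleTime, .usedTime, .size, .counting, .restoring, .restored] i
  refine Finite.of_surjective f fun p => ?_
  cases p with
  | st q => exact ⟨.inl q, rfl⟩
  | pend e => exact ⟨.inr (.inl e), rfl⟩
  | cnt r => exact ⟨.inr (.inr (.inl r)), rfl⟩
  | cop r => exact ⟨.inr (.inr (.inr (.inl r))), rfl⟩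
  | halt => exact ⟨.inr (.inr (.inr (.inr 0))), rfl⟩
  | idleTime => exact ⟨.inr (.inr (.inr (.inr 1))), rfl⟩
  | usedTime => exact ⟨.inr (.inr (.inr (.inr 2))), rfl⟩
  | size => exact ⟨.inr (.inr (.inr (.inr 3))), rfl⟩
  | counting => exact ⟨.inr (.inr (.inr (.inr 4))), rfl⟩
  | restoring => exact ⟨.inr (.inr (.inr (.inr 5))), rfl⟩
  | restored => exact ⟨.inr (.inr (.inr (.inr 6))), rfl⟩

theorem Trans.finite (Q E R : Type) [Finite Q] [Finite E] [Finite R] : Finite (Trans Q E R) := by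
  have := Place.finite Q E R
  let f : E ⊕ E ⊕ E ⊕ E ⊕ {p : Place Q E R // p ≠ .halt} ⊕ Fin 5 → Trans Q E R
    | .inl e => .fire e
    | .inr (.inl e) => .count e
    | .inr (.inr (.inl e)) => .restore e
    | .inr (.inr (.inr (.inl e))) => .resume e
    | .inr (.inr (.inr (.inr (.inl p)))) => .idle p
    | .inr (.inr (.inr (.inr (.inr i)))) => ![.tested, .reset, .grow, .finish, .drain] i
  refine Finite.of_surjective f fun t => ?_
  cases t with
  | fire e => exact ⟨.inl e, rfl⟩
  | count e => exact ⟨.inr (.inl e), rfl⟩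
  | restore e => exact ⟨.inr (.inr (.inl e)), rfl⟩
  | resume e => exact ⟨.inr (.inr (.inr (.inl e))), rfl⟩
  | idle p => exact ⟨.inr (.inr (.inr (.inr (.inl p)))), rfl⟩
  | tested => exact ⟨.inr (.inr (.inr (.inr (.inr 0)))), rfl⟩
  | reset => exact ⟨.inr (.inr (.inr (.inr (.inr 1)))), rfl⟩
  | grow => exact ⟨.inr (.inr (.inr (.inr (.inr 2)))), rfl⟩
  | finish => exact ⟨.inr (.inr (.inr (.inr (.inr 3)))), rfl⟩
  | drain => exact ⟨.inr (.inr (.inr (.inr (.inr 4)))), rfl⟩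

variable {R : Type} (K : CounterMachine R)

/-- The places of the net of `K`. -/
abbrev P : Type := Place K.State K.Edge R

/-- The transitions of the net of `K`. -/
abbrev T : Type := Trans K.State K.Edge R

/-- What the control of a net is doing. -/
inductive Control : Type
  | run (q : K.State)
  | count (e : K.Edge)
  | restore (e : K.Edge)
  | resume (e : K.Edge)
  | halt

section

open scoped Classical in
/-- One token in the place `p`. -/
noncomputable def tok (p : K.P) : K.P → ℕ := fun p' => if p' = p then 1 else 0

/-- One token in every complement place. -/
def cops : K.P → ℕ
  | .cop _ => 1
  | _ => 0

open scoped Classical in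
/-- One token in the complement of the register tested by `e`, if any. -/
noncomputable def testTok (e : K.Edge) : K.P → ℕ
  | .cop r => if K.op e = .zero r then 1 else 0
  | _ => 0

open scoped Classical in
/-- The tokens of the registers that are consumed by the edge `e`. -/
noncomputable def opIns (e : K.Edge) : K.P → ℕ
  | .cnt r => if K.op e = .dec r then 1 else 0
  | .cop r => if K.op e = .inc r then 1 else 0
  | _ => 0

open scoped Classical in
/-- The tokens that are produced by the edge `e`; a zero test is suspended until it has been
carried out. -/
noncomputable def opOuts (e : K.Edge) : K.P → ℕ
  | .cnt r => if K.op e = .inc r then 1 else 0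
  | .cop r => if K.op e = .dec r then 1 else 0
  | .st q => if q = K.dst e ∧ ∀ r, K.op e ≠ .zero r then 1 else 0
  | .pend e' => if e' = e ∧ ∃ r, K.op e = .zero r then 1 else 0
  | .counting => if ∃ r, K.op e = .zero r then 1 else 0
  | _ => 0

/-- The weights of the ordinary arcs into a transition. -/
noncomputable def ins : K.T → K.P → ℕ
  | .fire e => K.tok (.st (K.src e)) + K.opIns e
  | .count e => K.tok (.pend e) + K.tok .counting + K.tok .idleTime + K.testTok e
  | .restore e => K.tok (.pend e) + K.tok .restoring + K.tok .usedTime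
  | .resume e => K.tok (.pend e) + K.tok .restored
  | .tested => K.tok .counting
  | .reset => K.tok .restoring
  | .grow => K.tok (.st K.start)
  | .finish => K.tok (.st K.finish)
  | .drain => K.tok .halt + K.tok .idleTime + K.tok .size + K.cops
  | .idle p => K.tok p

/-- The weights of the arcs out of a transition. -/
noncomputable def outs : K.T → K.P → ℕ
  | .fire e => K.opOuts e
  | .count e => K.tok (.pend e) + K.tok .counting + K.tok .usedTime
  | .restore e => K.tok (.pend e) + K.tok .restoring + K.tok .idleTime + K.testTok e
  | .resume e => K.tok (.st (K.dst e))
  | .tested => K.tok .restoring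
  | .reset => K.tok .restored
  | .grow => K.tok (.st K.start) + K.tok .idleTime + K.tok .size + K.cops
  | .finish => K.tok .halt
  | .drain => K.tok .halt
  | .idle p => K.tok p

open scoped Classical in
/-- The marking given by the control, the registers, their complements, and the timer. -/
noncomputable def marking (x : K.Control) (s d : R → ℕ) (a b k : ℕ) : K.P → ℕ
  | .st q => if x = .run q then 1 else 0
  | .pend e => if x = .count e ∨ x = .restore e ∨ x = .resume e then 1 else 0
  | .halt => if x = .halt then 1 else 0
  | .cnt r => s r
  | .cop r => d r
  | .idleTime => a
  | .usedTime => b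
  | .size => k
  | .counting => if ∃ e, x = .count e then 1 else 0
  | .restoring => if ∃ e, x = .restore e then 1 else 0
  | .restored => if ∃ e, x = .resume e then 1 else 0

/-- The net of a counter machine, with a given initial marking. -/
noncomputable def net (M : K.P → ℕ) : IRPetriNet K.P K.T where
  pre
    | .idleTime, .tested => .inhibitor
    | .usedTime, .reset => .reset
    | p, t => .weight (K.ins t p)
  post := K.outs
  init := M

end

theorem net_oneInhibitorOneReset (M : K.P → ℕ) : (K.net M).OneInhibitorOneReset := by
  constructor
  · rw [Set.ncard_eq_one]
    refine ⟨(.idleTime, .tested), ?_⟩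
    ext ⟨p, t⟩
    cases p <;> cases t <;> simp [IRPetriNet.inhibitorArcs, net]
  · rw [Set.ncard_eq_one]
    refine ⟨(.usedTime, .reset), ?_⟩
    ext ⟨p, t⟩
    cases p <;> cases t <;> simp [IRPetriNet.resetArcs, net]

variable {K} {M : K.P → ℕ}

/-- `ins` vanishes on the inhibitor and reset arcs, so all arcs can be treated as ordinary with one
extra condition for `tested`. -/
theorem net_firable_iff {M' : K.P → ℕ} {t : K.T} : (K.net M).Firable M' t ↔
    (∀ p, K.ins t p ≤ M' p) ∧ (t = .tested → M' .idleTime = 0) := by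
  constructor
  · intro h
    refine ⟨fun p => ?_, ?_⟩
    · have := h p
      cases t <;> cases p <;> first | exact this | simp [ins, tok]
    · rintro rfl
      exact h .idleTime
  · rintro ⟨h, h'⟩ p
    have := h p
    cases t <;> cases p <;> first | exact this | exact h' rfl | trivial

open scoped Classical in
theorem net_fire {M' : K.P → ℕ} {t : K.T} (p : K.P) : (K.net M).fire M' t p =
    if t = .reset ∧ p = .usedTime then 0 else M' p - K.ins t p + K.outs t p := by
  cases t <;> cases p <;> simp [IRPetriNet.fire, net, ins, outs, tok]

variable {s d : R → ℕ} {a b k : ℕ} {x : K.Control} {e : K.Edge} {r : R}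

/-- This computation and those that follow need no firability hypothesis: where a place might lack
tokens, both sides use truncated subtraction. -/
theorem fire_skip (h : K.op e = .skip) : (K.net M).fire (K.marking (.run (K.src e)) s d a b k)
    (.fire e) = K.marking (.run (K.dst e)) s d a b k := by
  ext p
  rw [net_fire]
  cases p <;> simp [marking, ins, outs, tok, opIns, opOuts, h, eq_comm]
  grind

theorem fire_inc [DecidableEq R] (h : K.op e = .inc r) : (K.net M).fire (K.marking (.run (K.src e)) s d a b k)
    (.fire e) = K.marking (.run (K.dst e)) (Function.update s r (s r + 1))
      (Function.update d r (d r - 1)) a b k := by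
  ext p
  rw [net_fire]
  cases p <;> simp [marking, ins, outs, tok, opIns, opOuts, h, eq_comm, Function.update_apply] <;>
    grind

theorem fire_dec [DecidableEq R] (h : K.op e = .dec r) : (K.net M).fire (K.marking (.run (K.src e)) s d a b k)
    (.fire e) = K.marking (.run (K.dst e)) (Function.update s r (s r - 1))
      (Function.update d r (d r + 1)) a b k := by
  ext p
  rw [net_fire]
  cases p <;> simp [marking, ins, outs, tok, opIns, opOuts, h, eq_comm, Function.update_apply] <;>
    grind

theorem fire_zero (h : K.op e = .zero r) : (K.net M).fire (K.marking (.run (K.src e)) s d a b k)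
    (.fire e) = K.marking (.count e) s d a b k := by
  ext p
  rw [net_fire]
  cases p <;> simp [marking, ins, outs, tok, opIns, opOuts, h, eq_comm] <;>
    first | grind | (split_ifs <;> simp_all)

theorem fire_count [DecidableEq R] (h : K.op e = .zero r) : (K.net M).fire (K.marking (.count e) s d a b k)
    (.count e) = K.marking (.count e) s (Function.update d r (d r - 1)) (a - 1) (b + 1) k := by
  ext p
  rw [net_fire]
  cases p <;> simp [marking, ins, outs, tok, testTok, h, eq_comm, Function.update_apply] <;> grind

theorem fire_tested : (K.net M).fire (K.marking (.count e) s d a b k)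
    .tested = K.marking (.restore e) s d a b k := by
  ext p
  rw [net_fire]
  cases p <;> simp [marking, ins, outs, tok]
  grind

theorem fire_restore [DecidableEq R] (h : K.op e = .zero r) : (K.net M).fire (K.marking (.restore e) s d a b k)
    (.restore e) = K.marking (.restore e) s (Function.update d r (d r + 1)) (a + 1) (b - 1) k := by
  ext p
  rw [net_fire]
  cases p <;> simp [marking, ins, outs, tok, testTok, h, eq_comm, Function.update_apply] <;> grind

theorem fire_reset : (K.net M).fire (K.marking (.restore e) s d a b k)
    .reset = K.marking (.resume e) s d a 0 k := by
  ext p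
  rw [net_fire]
  cases p <;> simp [marking, ins, outs, tok]
  grind

theorem fire_resume : (K.net M).fire (K.marking (.resume e) s d a b k)
    (.resume e) = K.marking (.run (K.dst e)) s d a b k := by
  ext p
  rw [net_fire]
  cases p <;> simp [marking, ins, outs, tok, eq_comm] <;> grind

theorem fire_grow : (K.net M).fire (K.marking (.run K.start) s d a b k)
    .grow = K.marking (.run K.start) s (fun r => d r + 1) (a + 1) b (k + 1) := by
  ext p
  rw [net_fire]
  cases p <;> simp [marking, ins, outs, tok, cops, eq_comm]
  grind

theorem fire_finish : (K.net M).fire (K.marking (.run K.finish) s d a b k)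
    .finish = K.marking .halt s d a b k := by
  ext p
  rw [net_fire]
  cases p <;> simp [marking, ins, outs, tok, eq_comm]
  grind

theorem fire_drain : (K.net M).fire (K.marking .halt s d a b k)
    .drain = K.marking .halt s (fun r => d r - 1) (a - 1) b (k - 1) := by
  ext p
  rw [net_fire]
  cases p <;> simp [marking, ins, outs, tok, cops]

end CounterMachine

/-! ### Soundness: emptying the net forces a faithful simulation. -/

namespace CounterMachine

variable {R : Type} [DecidableEq R] {K : CounterMachine R} {M : K.P → ℕ}
variable {s d : R → ℕ} {a b k : ℕ} {x : K.Control} {e : K.Edge} {r : R}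

theorem one_le_ite_iff (p : Prop) [Decidable p] : (1 ≤ if p then 1 else 0) ↔ p := by
  split_ifs <;> simp [*]

omit [DecidableEq R] in
theorem control_of_firable {t : K.T} (h : (K.net M).Firable (K.marking x s d a b k) t) :
    match t with
    | .fire e => x = .run (K.src e)
    | .count e => x = .count e ∧ 1 ≤ a
    | .restore e => x = .restore e ∧ 1 ≤ b
    | .resume e => x = .resume e
    | .tested => (∃ e, x = .count e) ∧ a = 0
    | .reset => ∃ e, x = .restore e
    | .grow => x = .run K.start
    | .finish => x = .run K.finish
    | .drain => x = .halt ∧ 1 ≤ a ∧ 1 ≤ k ∧ ∀ r, 1 ≤ d r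
    | .idle _ => True := by
  obtain ⟨h, h'⟩ := net_firable_iff.1 h
  cases t with
  | fire e => simpa [one_le_ite_iff, ins, tok, opIns, marking] using h (.st (K.src e))
  | count e =>
    have h1 := h .counting
    have h2 := h (.pend e)
    have h3 := h .idleTime
    simp [ins, tok, testTok, marking] at h1 h2 h3
    grind
  | restore e =>
    have h1 := h .restoring
    have h2 := h (.pend e)
    have h3 := h .usedTime
    simp [ins, tok, marking] at h1 h2 h3
    grind
  | resume e =>
    have h1 := h .restored
    have h2 := h (.pend e)
    simp [ins, tok, marking] at h1 h2
    grind
  | tested =>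
    exact ⟨by simpa [one_le_ite_iff, ins, tok, marking] using h .counting, h' rfl⟩
  | reset => simpa [one_le_ite_iff, ins, tok, marking] using h .restoring
  | grow => simpa [one_le_ite_iff, ins, tok, marking] using h (.st K.start)
  | finish => simpa [one_le_ite_iff, ins, tok, marking] using h (.st K.finish)
  | drain =>
    refine ⟨by simpa [one_le_ite_iff, ins, tok, cops, marking] using h .halt,
      by simpa [one_le_ite_iff, ins, tok, cops, marking] using h .idleTime,
      by simpa [one_le_ite_iff, ins, tok, cops, marking] using h .size,
      fun r => by simpa [one_le_ite_iff, ins, tok, cops, marking] using h (.cop r)⟩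
  | idle p => trivial

omit [DecidableEq R] in
theorem fire_idle {M' : K.P → ℕ} {p} (h : (K.net M).Firable M' (.idle p)) :
    (K.net M).fire M' (.idle p) = M' := by
  ext p'
  have := (net_firable_iff.1 h).1 p'
  rw [net_fire]
  simp only [ins, outs] at this ⊢
  simp only [reduceCtorEq, false_and, if_false]
  omega

omit [DecidableEq R] in
/-- Tokens of the timer that have been lost stay lost. -/
theorem timer_lt_of_fire {M' : K.P → ℕ} {t : K.T} (h : (K.net M).Firable M' t)
    (hM : M' .idleTime + M' .usedTime < M' .size) :
    (K.net M).fire M' t .idleTime + (K.net M).fire M' t .usedTime < (K.net M).fire M' t .size := by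
  have hA := (net_firable_iff.1 h).1 .idleTime
  have hB := (net_firable_iff.1 h).1 .usedTime
  have hS := (net_firable_iff.1 h).1 .size
  cases t with
  | idle p => rwa [fire_idle h]
  | _ =>
    simp [net_fire, ins, outs, tok, testTok, opIns, opOuts, cops] at hA hB hS ⊢
    omega

/-- The markings that occur in runs in which no token of the timer has been lost, when the machine
is started with the registers `s₀`. -/
def Faithful (K : CounterMachine R) (s₀ : R → ℕ) (x : K.Control) (s d : R → ℕ) (b k : ℕ) : Prop :=
  match x with
  | .run q => b = 0 ∧ (∀ r, s r + d r = k) ∧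
      Relation.ReflTransGen K.Step (K.start, s₀) (q, s)
  | .count e => ∃ r, K.op e = .zero r ∧ (∀ r', s r' + d r' + (if r' = r then b else 0) = k) ∧
      Relation.ReflTransGen K.Step (K.start, s₀) (K.src e, s)
  | .restore e => ∃ r, K.op e = .zero r ∧ (∀ r', s r' + d r' + (if r' = r then b else 0) = k) ∧
      s r = 0 ∧ Relation.ReflTransGen K.Step (K.start, s₀) (K.src e, s)
  | .resume e => b = 0 ∧ (∀ r, s r + d r = k) ∧
      Relation.ReflTransGen K.Step (K.start, s₀) (K.dst e, s)
  | .halt => b = 0 ∧ (∀ r, s r + d r = k) ∧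
      Relation.ReflTransGen K.Step (K.start, s₀) (K.finish, s)

/-- In a reachable marking, either some token of the timer has been lost, or the run is faithful. -/
def Invariant (K : CounterMachine R) (s₀ : R → ℕ) (M : K.P → ℕ) : Prop :=
  M .idleTime + M .usedTime < M .size ∨
    ∃ x s d a b k, M = K.marking x s d a b k ∧ a + b = k ∧ K.Faithful s₀ x s d b k

/-- Faithfulness can fail only at `reset`, and there exactly by losing timer tokens, which is never
repaired. -/
theorem Invariant.fire {s₀ : R → ℕ} {M' : K.P → ℕ} {t : K.T} (hM : K.Invariant s₀ M')
    (h : (K.net M).Firable M' t) : K.Invariant s₀ ((K.net M).fire M' t) := by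
  rcases hM with hM | ⟨x, s, d, a, b, k, rfl, hab, hf⟩
  · exact Or.inl (timer_lt_of_fire h hM)
  have hc := control_of_firable h
  have hins := (net_firable_iff.1 h).1
  cases t with
  | idle p =>
    rw [fire_idle h]
    exact Or.inr ⟨x, s, d, a, b, k, rfl, hab, hf⟩
  | fire e =>
    obtain rfl : x = _ := hc
    obtain ⟨hb, hk, hr⟩ := hf
    cases hop : K.op e with
    | skip =>
      rw [fire_skip hop]
      refine Or.inr ⟨_, _, _, _, _, _, rfl, hab, hb, hk, hr.tail ⟨e, rfl, rfl, ?_⟩⟩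
      rw [hop]; rfl
    | inc r =>
      have h1 : 1 ≤ d r := by simpa [ins, tok, opIns, marking, hop] using hins (.cop r)
      rw [fire_inc hop]
      refine Or.inr ⟨_, _, _, _, _, _, rfl, hab, hb, fun r' => ?_, hr.tail ⟨e, rfl, rfl, ?_⟩⟩
      · have := hk r'
        rcases eq_or_ne r' r with rfl | hne
        · simp only [Function.update_self]; omega
        · simpa only [Function.update_of_ne hne]
      · rw [hop]; rfl
    | dec r =>
      have h1 : 1 ≤ s r := by simpa [ins, tok, opIns, marking, hop] using hins (.cnt r)
      rw [fire_dec hop]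
      refine Or.inr ⟨_, _, _, _, _, _, rfl, hab, hb, fun r' => ?_, hr.tail ⟨e, rfl, rfl, ?_⟩⟩
      · have := hk r'
        rcases eq_or_ne r' r with rfl | hne
        · simp only [Function.update_self]; omega
        · simpa only [Function.update_of_ne hne]
      · rw [hop]; exact ⟨h1, rfl⟩
    | zero r =>
      rw [fire_zero hop]
      exact Or.inr ⟨_, _, _, _, _, _, rfl, hab, r, hop, fun r' => by simp [hb, hk r'], hr⟩
  | count e =>
    obtain ⟨rfl, ha⟩ : x = _ ∧ _ := hc
    obtain ⟨r, hop, hk, hr⟩ := hf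
    have h1 : 1 ≤ d r := by simpa [ins, tok, testTok, marking, hop] using hins (.cop r)
    rw [fire_count hop]
    refine Or.inr ⟨_, _, _, _, _, _, rfl, by omega, r, hop, fun r' => ?_, hr⟩
    have := hk r'
    rcases eq_or_ne r' r with rfl | hne
    · simp only [Function.update_self, if_true] at this ⊢; omega
    · simpa only [Function.update_of_ne hne, if_neg hne] using this
  | restore e =>
    obtain ⟨rfl, hb⟩ : x = _ ∧ _ := hc
    obtain ⟨r, hop, hk, hr⟩ := hf
    rw [fire_restore hop]
    refine Or.inr ⟨_, _, _, _, _, _, rfl, by omega, r, hop, fun r' => ?_, hr⟩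
    have := hk r'
    rcases eq_or_ne r' r with rfl | hne
    · simp only [Function.update_self, if_true] at this ⊢; omega
    · simpa only [Function.update_of_ne hne, if_neg hne] using this
  | resume e =>
    obtain rfl : x = _ := hc
    rw [fire_resume]
    exact Or.inr ⟨_, _, _, _, _, _, rfl, hab, hf⟩
  | tested =>
    obtain ⟨⟨e, rfl⟩, ha⟩ := hc
    obtain ⟨r, hop, hk, hr⟩ := hf
    rw [fire_tested]
    refine Or.inr ⟨_, _, _, _, _, _, rfl, hab, r, hop, hk, ?_, hr⟩
    -- Since `a = 0`, `b = k`, and then `s r + d r + b = k` leaves nothing for `s r`.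
    have := hk r
    simp only [if_true] at this
    omega
  | reset =>
    obtain ⟨e, rfl⟩ := hc
    obtain ⟨r, hop, hk, hs, hr⟩ := hf
    rw [fire_reset]
    -- Either everything was restored and the test counts as a step of the machine, or `b > 0`
    -- tokens vanish from the timer.
    rcases Nat.eq_zero_or_pos b with rfl | hb
    · refine Or.inr ⟨_, _, _, _, _, _, rfl, hab, rfl, fun r' => by simpa using hk r',
        hr.tail ⟨e, rfl, rfl, ?_⟩⟩
      rw [hop]; exact ⟨hs, rfl⟩
    · exact Or.inl (by simp only [marking]; omega)
  | grow =>
    obtain rfl : x = _ := hc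
    obtain ⟨hb, hk, hr⟩ := hf
    rw [fire_grow]
    exact Or.inr ⟨_, _, _, _, _, _, rfl, by omega, hb, fun r => by have := hk r; beta_reduce; omega, hr⟩
  | finish =>
    obtain rfl : x = _ := hc
    rw [fire_finish]
    exact Or.inr ⟨_, _, _, _, _, _, rfl, hab, hf⟩
  | drain =>
    obtain ⟨rfl, ha, hk1, hd⟩ : x = _ ∧ _ := hc
    obtain ⟨hb, hk, hr⟩ := hf
    rw [fire_drain]
    exact Or.inr ⟨_, _, _, _, _, _, rfl, by omega, hb,
      fun r => by have := hk r; have := hd r; beta_reduce; omega, hr⟩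

/-- The marking in which the registers have the values `s`, each bounded by `k`. -/
noncomputable abbrev runMarking (K : CounterMachine R) (q : K.State) (s : R → ℕ) (k : ℕ) :
    K.P → ℕ :=
  K.marking (.run q) s (fun r => k - s r) k 0 k

/-- The marking with a single token, in the halting place. -/
noncomputable abbrev haltMarking (K : CounterMachine R) : K.P → ℕ :=
  K.marking .halt 0 0 0 0 0

omit [DecidableEq R] in
theorem haltMarking_eq_zero {p : K.P} (hp : p ≠ .halt) : K.haltMarking p = 0 := by
  cases p <;> simp_all [marking]

/-- A run that ends with all places but the halting place empty simulates a halting run of the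
machine. -/
theorem halts_of_reachable {s₀ : R → ℕ} {n : ℕ} (hn : ∀ r, s₀ r ≤ n) {M : K.P → ℕ}
    (h : (K.net (K.runMarking K.start s₀ n)).Reachable M) (hM : ∀ p, p ≠ .halt → M p = 0) :
    Relation.ReflTransGen K.Step (K.start, s₀) (K.finish, 0) := by
  have hinv : K.Invariant s₀ M := by
    clear hM
    change Relation.ReflTransGen _ (K.runMarking K.start s₀ n) M at h
    induction h with
    | refl =>
      exact Or.inr ⟨_, _, _, _, _, _, rfl, rfl, rfl, fun r => Nat.add_sub_cancel' (hn r), .refl⟩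
    | tail _ hstep ih =>
      obtain ⟨t, ht, rfl⟩ := hstep
      exact ih.fire ht
  rcases hinv with hlt | ⟨x, s, d, a, b, k, rfl, hab, hf⟩
  · rw [hM .size (by simp)] at hlt
    omega
  have hk : k = 0 := hM .size (by simp)
  have ha : a = 0 := hM .idleTime (by simp)
  have hb : b = 0 := hM .usedTime (by simp)
  have hs : s = 0 := funext fun r => hM (.cnt r) (by simp)
  have hd : d = 0 := funext fun r => hM (.cop r) (by simp)
  subst hk ha hb hs hd
  cases x with
  | run q => simpa [marking] using hM (.st q) (by simp)
  | count e => simpa [marking] using hM (.pend e) (by simp)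
  | restore e => simpa [marking] using hM (.pend e) (by simp)
  | resume e => simpa [marking] using hM (.pend e) (by simp)
  | halt => exact hf.2.2

omit [DecidableEq R] in
theorem not_firable_haltMarking (t : K.T) : ¬ (K.net M).Firable K.haltMarking t := by
  intro h
  have hc := control_of_firable h
  cases t with
  | idle p =>
    have := (net_firable_iff.1 h).1 p
    rw [haltMarking_eq_zero p.2] at this
    simp [ins, tok] at this
  | _ => simp at hc

/-! ### Completeness: simulating a halting run. -/

theorem step_fire {q q' : K.State} {s s' : R → ℕ} (hs : ∀ r, s r ≤ k) (hs' : ∀ r, s' r ≤ k)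
    (h : K.Step (q, s) (q', s')) :
    Relation.ReflTransGen (K.net M).Step (K.runMarking q s k) (K.runMarking q' s' k) := by
  obtain ⟨e, rfl, rfl, he⟩ := h
  cases hop : K.op e with
  | skip =>
    rw [hop] at he
    obtain rfl : s' = s := he
    refine .single ⟨.fire e, net_firable_iff.2 ⟨fun p => ?_, by simp⟩, (fire_skip hop).symm⟩
    cases p <;> simp [ins, tok, opIns, marking, hop]
    grind
  | inc r =>
    rw [hop] at he
    obtain rfl : s' = _ := he
    have hr : s r + 1 ≤ k := by simpa using hs' r
    refine .single ⟨.fire e, net_firable_iff.2 ⟨fun p => ?_, by simp⟩, ?_⟩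
    · cases p <;> simp [ins, tok, opIns, marking, hop] <;> grind
    · rw [fire_inc hop, runMarking]
      congr 1
      ext r'
      simp only [Function.update_apply]
      split_ifs with h
      · subst h; omega
      · rfl
  | dec r =>
    rw [hop] at he
    obtain ⟨h0, rfl⟩ : 0 < s r ∧ s' = _ := he
    have hr := hs r
    refine .single ⟨.fire e, net_firable_iff.2 ⟨fun p => ?_, by simp⟩, ?_⟩
    · cases p <;> simp [ins, tok, opIns, marking, hop] <;> grind
    · rw [fire_dec hop, runMarking]
      congr 1
      ext r'
      simp only [Function.update_apply]
      split_ifs with h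
      · subst h; omega
      · rfl
  | zero r =>
    rw [hop] at he
    obtain ⟨h0, rfl⟩ : s r = 0 ∧ s' = s := he
    -- The complements after `j` units have been counted; `cop r` starts at `k` because register `r`
    -- is zero.
    let d : ℕ → R → ℕ := fun j => Function.update (fun r => k - s' r) r (k - j)
    have hd0 : d 0 = fun r => k - s' r := by
      ext r'; simp only [d, Function.update_apply]; grind
    have hstart : (K.net M).Step (K.runMarking (K.src e) s' k)
        (K.marking (.count e) s' (d 0) k 0 k) := by
      refine ⟨.fire e, net_firable_iff.2 ⟨fun p => ?_, by simp⟩, by rw [fire_zero hop, hd0]⟩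
      cases p <;> simp [ins, tok, opIns, marking, hop]
      grind
    have hcount : ∀ j, j ≤ k → Relation.ReflTransGen (K.net M).Step
        (K.marking (.count e) s' (d 0) k 0 k) (K.marking (.count e) s' (d j) (k - j) j k) := by
      intro j hj
      induction j with
      | zero => exact .refl
      | succ j ih =>
        refine (ih (by omega)).tail ⟨.count e, net_firable_iff.2 ⟨fun p => ?_, by simp⟩, ?_⟩
        · cases p <;> simp [ins, tok, testTok, marking, hop, d] <;> grind
        · rw [fire_count hop]
          congr 1
          simp [d, Nat.sub_sub]
    have htested : (K.net M).Step (K.marking (.count e) s' (d k) (k - k) k k)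
        (K.marking (.restore e) s' (d k) (k - k) k k) := by
      refine ⟨.tested, net_firable_iff.2 ⟨fun p => ?_, by simp [marking]⟩, fire_tested.symm⟩
      cases p <;> simp [ins, tok, marking]
    have hrestore : ∀ j, j ≤ k → Relation.ReflTransGen (K.net M).Step
        (K.marking (.restore e) s' (d k) (k - k) k k)
        (K.marking (.restore e) s' (d (k - j)) j (k - j) k) := by
      intro j hj
      induction j with
      | zero => rw [Nat.sub_self, Nat.sub_zero]
      | succ j ih =>
        refine (ih (by omega)).tail ⟨.restore e, net_firable_iff.2 ⟨fun p => ?_, by simp⟩, ?_⟩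
        · cases p <;> simp [ins, tok, marking] <;> grind
        · rw [fire_restore hop]
          congr 1
          simp only [d, Function.update_self, Function.update_idem]
          congr 1
          omega
    have hreset : (K.net M).Step (K.marking (.restore e) s' (d (k - k)) k (k - k) k)
        (K.marking (.resume e) s' (d (k - k)) k 0 k) := by
      refine ⟨.reset, net_firable_iff.2 ⟨fun p => ?_, by simp⟩, fire_reset.symm⟩
      cases p <;> simp [ins, tok, marking]
    have hresume : (K.net M).Step (K.marking (.resume e) s' (d (k - k)) k 0 k)
        (K.runMarking (K.dst e) s' k) := by
      refine ⟨.resume e, net_firable_iff.2 ⟨fun p => ?_, by simp⟩, ?_⟩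
      · cases p <;> simp [ins, tok, marking]
        grind
      · rw [fire_resume, Nat.sub_self, hd0]
    exact .head hstart (((hcount k le_rfl).tail htested).trans
      (((hrestore k le_rfl).tail hreset).tail hresume))

/-- A finite run has bounded registers; the simulation works for every capacity `k` above the bound,
so `grow` may overshoot. -/
theorem exists_bound_run [Finite R] {y z : K.State × (R → ℕ)}
    (h : Relation.ReflTransGen K.Step y z) : ∃ n, (∀ r, z.2 r ≤ n) ∧ ∀ k, n ≤ k →
      Relation.ReflTransGen (K.net M).Step (K.runMarking y.1 y.2 k) (K.runMarking z.1 z.2 k) := by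
  have hbdd : ∀ s : R → ℕ, ∃ n, ∀ r, s r ≤ n := fun s => by
    obtain ⟨n, hn⟩ := (Set.finite_range s).bddAbove
    exact ⟨n, fun r => hn ⟨r, rfl⟩⟩
  induction h with
  | refl =>
    obtain ⟨n, hn⟩ := hbdd y.2
    exact ⟨n, hn, fun _ _ => .refl⟩
  | @tail z w _ hstep ih =>
    obtain ⟨n, hn, hrun⟩ := ih
    obtain ⟨m, hm⟩ := hbdd w.2
    exact ⟨max n m, fun r => (hm r).trans (le_max_right _ _), fun k hk =>
      (hrun k (le_of_max_le_left hk)).trans (step_fire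
        (fun r => (hn r).trans (le_of_max_le_left hk))
        (fun r => (hm r).trans (le_of_max_le_right hk)) hstep)⟩

/-- A halting run of the machine is simulated by a run of the net. -/
theorem reachable_haltMarking [Finite R] {s₀ : R → ℕ} {n : ℕ} (hn : ∀ r, s₀ r ≤ n)
    (h : Relation.ReflTransGen K.Step (K.start, s₀) (K.finish, 0)) :
    (K.net (K.runMarking K.start s₀ n)).Reachable K.haltMarking := by
  set N := K.net (K.runMarking K.start s₀ n) with hN
  have hgrow : ∀ j, Relation.ReflTransGen N.Step (K.runMarking K.start s₀ n)
      (K.runMarking K.start s₀ (n + j)) := by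
    intro j
    induction j with
    | zero => exact .refl
    | succ j ih =>
      refine ih.tail ⟨.grow, net_firable_iff.2 ⟨fun p => ?_, by simp⟩, ?_⟩
      · cases p <;> simp [ins, tok, marking]
        grind
      · rw [hN, fire_grow, runMarking]
        congr 1
        ext r
        have := hn r
        omega
  obtain ⟨m, -, hm⟩ := exists_bound_run (M := K.runMarking K.start s₀ n) h
  have hfinish : N.Step (K.runMarking K.finish 0 (n + m)) (K.marking .halt 0 (fun _ => n + m) (n + m) 0
      (n + m)) := by
    refine ⟨.finish, net_firable_iff.2 ⟨fun p => ?_, by simp⟩, ?_⟩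
    · cases p <;> simp [ins, tok, marking]
      grind
    · rw [hN, fire_finish]; rfl
  have hdrain : ∀ j, Relation.ReflTransGen N.Step (K.marking .halt 0 (fun _ => j) j 0 j)
      K.haltMarking := by
    intro j
    induction j with
    | zero => exact .refl
    | succ j ih =>
      refine .head ⟨.drain, net_firable_iff.2 ⟨fun p => ?_, by simp⟩, ?_⟩ ih
      · cases p <;> simp [ins, tok, cops, marking]
      · rw [hN, fire_drain]; rfl
  exact (((hgrow m).trans (hm _ (by omega))).tail hfinish).trans (hdrain _)

end CounterMachine

/-! ### Invariance under renaming. -/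

namespace IRPetriNet

variable {P T P' T' : Type*}

/-- The net with renamed places and transitions. -/
def reindex (N : IRPetriNet P T) (f : P ≃ P') (g : T ≃ T') : IRPetriNet P' T' where
  pre p t := N.pre (f.symm p) (g.symm t)
  post t p := N.post (g.symm t) (f.symm p)
  init p := N.init (f.symm p)

variable {N : IRPetriNet P T} {f : P ≃ P'} {g : T ≃ T'}

theorem reindex_firable_iff {M : P' → ℕ} {t : T'} :
    (N.reindex f g).Firable M t ↔ N.Firable (M ∘ f) (g.symm t) := by
  constructor
  · intro h p
    simpa [reindex] using h (f p)
  · intro h p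
    simpa [reindex] using h (f.symm p)

theorem reindex_fire {M : P' → ℕ} {t : T'} :
    (N.reindex f g).fire M t ∘ f = N.fire (M ∘ f) (g.symm t) := by
  ext p
  simp [reindex, fire]

theorem reindex_step_iff {M M' : P' → ℕ} :
    (N.reindex f g).Step M M' ↔ N.Step (M ∘ f) (M' ∘ f) := by
  constructor
  · rintro ⟨t, ht, rfl⟩
    exact ⟨_, reindex_firable_iff.1 ht, reindex_fire⟩
  · rintro ⟨t, ht, h⟩
    refine ⟨g t, reindex_firable_iff.2 (by simpa using ht), f.surjective.injective_comp_right ?_⟩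
    change _ ∘ f = _ ∘ f
    rw [h, reindex_fire, Equiv.symm_apply_apply]

theorem reindex_reachable_iff {M : P' → ℕ} :
    (N.reindex f g).Reachable M ↔ N.Reachable (M ∘ f) := by
  have hinit : (N.reindex f g).init ∘ f = N.init := by
    ext p; simp [reindex]
  unfold Reachable
  constructor
  · intro h
    rw [← hinit]
    exact h.lift (· ∘ f) fun _ _ => reindex_step_iff.1
  · intro h
    have := h.lift (p := (N.reindex f g).Step) (· ∘ f.symm) fun M M' hM =>
      reindex_step_iff.2 (by simpa [Function.comp_assoc] using hM)
    rw [Function.onFun, Function.comp_assoc, Equiv.self_comp_symm, Function.comp_id] at this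
    exact this

theorem reindex_reachesDeadlock_iff :
    (N.reindex f g).ReachesDeadlock ↔ N.ReachesDeadlock := by
  constructor
  · rintro ⟨M, hM, h⟩
    refine ⟨M ∘ f, reindex_reachable_iff.1 hM, fun t ht => h (g t) (reindex_firable_iff.2 ?_)⟩
    rwa [Equiv.symm_apply_apply]
  · rintro ⟨M, hM, h⟩
    have hf : (M ∘ f.symm) ∘ f = M := by ext p; simp
    refine ⟨M ∘ f.symm, reindex_reachable_iff.2 (by rwa [hf]), fun t ht => h (g.symm t) ?_⟩
    rw [reindex_firable_iff, hf] at ht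
    exact ht

theorem reindex_oneInhibitorOneReset (h : N.OneInhibitorOneReset) :
    (N.reindex f g).OneInhibitorOneReset := by
  have h1 : (N.reindex f g).inhibitorArcs = f.prodCongr g '' N.inhibitorArcs := by
    rw [Equiv.image_eq_preimage_symm]; rfl
  have h2 : (N.reindex f g).resetArcs = f.prodCongr g '' N.resetArcs := by
    rw [Equiv.image_eq_preimage_symm]; rfl
  rw [OneInhibitorOneReset, h1, h2, Set.ncard_image_of_injective _ (Equiv.injective _),
    Set.ncard_image_of_injective _ (Equiv.injective _)]
  exact h

end IRPetriNet

/-! ### The reduction from the halting problem. -/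

namespace CounterMachine

variable {R : Type} [DecidableEq R] {K : CounterMachine R} {s₀ : R → ℕ} {n : ℕ}

theorem net_reachable_haltMarking_iff [Finite R] (hn : ∀ r, s₀ r ≤ n) :
    (K.net (K.runMarking K.start s₀ n)).Reachable K.haltMarking ↔
      Relation.ReflTransGen K.Step (K.start, s₀) (K.finish, 0) :=
  ⟨fun h => halts_of_reachable hn h fun _ => haltMarking_eq_zero, reachable_haltMarking hn⟩

theorem net_reachesDeadlock_iff [Finite R] (hn : ∀ r, s₀ r ≤ n) :
    (K.net (K.runMarking K.start s₀ n)).ReachesDeadlock ↔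
      Relation.ReflTransGen K.Step (K.start, s₀) (K.finish, 0) := by
  constructor
  · rintro ⟨M, hM, hdead⟩
    refine halts_of_reachable hn hM fun p hp => ?_
    by_contra hne
    -- A token in `p` would enable its idle transition.
    refine hdead (.idle ⟨p, hp⟩) (net_firable_iff.2 ⟨fun p' => ?_, by simp⟩)
    simp only [ins, tok]
    split_ifs with h
    · subst h; omega
    · omega
  · exact fun h => ⟨_, reachable_haltMarking hn h, not_firable_haltMarking⟩

theorem primrec_runMarking {k : ℕ} (K : CounterMachine (Fin (k + 1))) (q : K.State) (p : K.P) :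
    Primrec fun n => K.runMarking q (Pi.single 0 n) n p := by
  cases p with
  | cnt r =>
    rcases eq_or_ne r 0 with rfl | hr
    · exact Primrec.id.of_eq fun n => by simp [marking]
    · simpa [marking, hr] using Primrec.const 0
  | cop r =>
    rcases eq_or_ne r 0 with rfl | hr
    · simpa [marking] using Primrec.const 0
    · exact Primrec.id.of_eq fun n => by simp [marking, hr]
  | idleTime => exact Primrec.id
  | size => exact Primrec.id
  | _ => exact Primrec.const _

end CounterMachine

/-- The halting problem as an existential quantification over a primitive recursive relation. -/
theorem exists_primrec'_halting : ∃ f : List.Vector ℕ 2 → ℕ, Nat.Primrec' f ∧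
    ∀ c : Nat.Partrec.Code, (∃ m, f (Encodable.encode c ::ᵥ m ::ᵥ List.Vector.nil) = 0) ↔
      (c.eval 0).Dom := by
  let f : List.Vector ℕ 2 → ℕ := fun v =>
    bif (Nat.Partrec.Code.evaln v.tail.head (Denumerable.ofNat Nat.Partrec.Code v.head) 0).isSome
    then 0 else 1
  have hf : Primrec f := by
    refine Primrec.cond (Primrec.option_isSome.comp (Nat.Partrec.Code.primrec_evaln.comp
      (((Primrec.vector_head.comp Primrec.vector_tail).pair
        ((Primrec.ofNat _).comp Primrec.vector_head)).pair (Primrec.const 0))))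
      (Primrec.const 0) (Primrec.const 1)
  refine ⟨f, Nat.Primrec'.of_prim hf, fun c => ?_⟩
  simp only [f, List.Vector.head_cons, List.Vector.tail_cons, Denumerable.ofNat_encode,
    Part.dom_iff_mem, Nat.Partrec.Code.evaln_complete]
  rw [exists_comm]
  refine exists_congr fun m => ?_
  cases h : Nat.Partrec.Code.evaln m c 0 <;> simp

/-- The reduction lands inside `C`, so even a partial algorithm becomes total after composition with
`F`. -/
theorem not_decidableOn_of_halting {α : Type*} [Primcodable α] {C Q : α → Prop}
    {F : Nat.Partrec.Code → α} (hF : Computable F) (hC : ∀ c, C (F c))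
    (hQ : ∀ c, Q (F c) ↔ (c.eval 0).Dom) : ¬ DecidableOn C Q := by
  classical
  rintro ⟨f, hf, h⟩
  refine ComputablePred.halting_problem 0 ⟨Classical.decPred _, ?_⟩
  refine (hf.comp hF).of_eq fun c => ?_
  obtain ⟨b, hb, hbQ⟩ := h _ (hC c)
  rw [Part.eq_some_iff.2 hb]
  rw [hQ] at hbQ
  simp only [PFun.coe_val, Part.some_inj]
  rw [← Bool.coe_iff_coe, hbQ, decide_eq_true_iff]

theorem mainTheorem8 :
    (¬ DecidableOn
        (fun x : NetCode × List ℕ => x.1.net.OneInhibitorOneReset)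
        (fun x : NetCode × List ℕ => x.1.net.Reachable (listMarking x.1.numPlaces x.2))) ∧
    (¬ DecidableOn
        (fun c : NetCode => c.net.OneInhibitorOneReset)
        (fun c : NetCode => c.net.ReachesDeadlock)) := by
  obtain ⟨f, hf, hhalt⟩ := exists_primrec'_halting
  obtain ⟨k, K, hK⟩ := CounterMachine.exists_recognizes hf
  have := K.finState
  have := K.finEdge
  have := CounterMachine.Place.finite K.State K.Edge (Fin (k + 1))
  have := CounterMachine.Trans.finite K.State K.Edge (Fin (k + 1))
  have eP := Finite.equivFin K.P
  have eT := Finite.equivFin K.T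
  let N : ℕ → IRPetriNet K.P K.T := fun n => K.net (K.runMarking K.start (Pi.single 0 n) n)
  have hle : ∀ n r, (Pi.single 0 n : Fin (k + 1) → ℕ) r ≤ n := fun n r => by
    rw [Pi.single_apply]; split_ifs <;> omega
  -- The arc tables of `N 0` serve all inputs, since `N n` depends on `n` only through its initial
  -- marking.
  obtain ⟨A, B, l, hcode⟩ := NetCode.exists_net_eq ((N 0).reindex eP eT)
  let init : ℕ → List ℕ := fun n => List.ofFn fun p => (N n).init (eP.symm p)
  let code : ℕ → NetCode := fun n => (Nat.card K.P, Nat.card K.T, A, B, init n)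
  have hlist : ∀ M : K.P → ℕ, listMarking (Nat.card K.P) (List.ofFn fun p => M (eP.symm p)) =
      M ∘ eP.symm := fun M => by ext p; simp [listMarking]
  have hnet : ∀ n, (code n).net = (N n).reindex eP eT := fun n => by
    have hpre := congrArg IRPetriNet.pre hcode
    have hpost := congrArg IRPetriNet.post hcode
    exact congr (congrArg₂ IRPetriNet.mk hpre hpost) (hlist (N n).init)
  have hinit : Primrec init := Primrec.list_ofFn fun p =>
    K.primrec_runMarking K.start (eP.symm p)
  have hprim : Primrec code := (Primrec.const _).pair ((Primrec.const _).pair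
    ((Primrec.const _).pair ((Primrec.const _).pair hinit)))
  have hF : Computable fun c : Nat.Partrec.Code => code (Encodable.encode c) :=
    hprim.to_comp.comp Computable.encode
  have hclass : ∀ n, (code n).net.OneInhibitorOneReset := fun n => by
    rw [hnet]
    exact IRPetriNet.reindex_oneInhibitorOneReset (K.net_oneInhibitorOneReset _)
  refine ⟨not_decidableOn_of_halting
    (hF.pair (Computable.const (List.ofFn fun p => K.haltMarking (eP.symm p))))
    (fun c => hclass _) fun c => ?_, not_decidableOn_of_halting hF (fun c => hclass _) fun c => ?_⟩
  · change (code _).net.Reachable (listMarking (Nat.card K.P) _) ↔ _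
    rw [hnet, hlist, IRPetriNet.reindex_reachable_iff, ← hhalt, ← hK,
      ← CounterMachine.net_reachable_haltMarking_iff (hle _)]
    simp [Function.comp_assoc, N]
  · rw [hnet, IRPetriNet.reindex_reachesDeadlock_iff, ← hhalt, ← hK,
      ← CounterMachine.net_reachesDeadlock_iff (hle _)]
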